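/- Let $D_s=\{z\in\mathbb C:|z|<s\}$ and $D=D_1$. For $E\subseteq\mathbb C$ let $H(E)$ be the set of functions analytic on (a neighbourhood of) $E$, and let $\omega(E)$ be the set of $f\in H(E)$ that are locally univalent in $E$ (injective in a neighbourhood of each point of $E$) with $f(0)=0$ and $f'(0)>0$. For an open set $U$, $H(U)$ carries the topology of locally uniform convergence. For $g$ on $\partial D$ put $$P[g](\xi)=\frac1{2\pi i}\int_{\partial D}g(z)\,\frac{z+\xi}{z-\xi}\,\frac{dz}{z},\qquad \xi\in D.$$ A strong* solution of $$f_t=\xi f'\,P\!\left[\frac1{|f'|^2}\right],\qquad \xi\in D,\tag{1}$$ on a time interval $I$ is a family $f(\cdot,t)\in\omega(\overline D)$, $t\in I$, that is continuously differentiable with respect to $t\in I$ and satisfies (1) for all $t\in I$; here $f'=\partial f/\partial\xi$ and $f_t=\partial f/\partial t$ (one-sided at endpoints of $I$). **Theorem (short-time existence of strong\* solutions).** Let $\rho_0>r>1$ and let $f_0\in\omega(\overline{D_r})\cap H(\overline{D_{\rho_0}})$. Then there exist $t_0>0$ and a strong* solution $f(\xi,t)$ of (1) on $[0,t_0]$ such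 that $f\in C^1([0,t_0],H(D_r))$, $f(\cdot,t)\in\omega(D_r)$ for every $t\in[0,t_0]$, and $f(\cdot,0)=f_0$ on $D_r$. -/

import Mathlib

open Set Filter Topology

noncomputable section

/-- `f` is univalent near every point of `E`. (Neighbourhoods are taken in `ℂ`: a function that is
analytic on a closed set `E` is by convention analytic on an open set containing `E`.) -/
def LocallyUnivalentOn (f : ℂ → ℂ) (E : Set ℂ) : Prop :=
  ∀ z ∈ E, ∃ U ∈ 𝓝 z, InjOn f U

/-- The class `ω(E)`: `f` is analytic on (a neighbourhood of) `E`, locally univalent in `E`,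
`f(0) = 0`, and `f'(0)` is a positive real number. -/
structure MemOmega (E : Set ℂ) (f : ℂ → ℂ) : Prop where
  analytic : AnalyticOnNhd ℂ f E
  locallyUnivalent : LocallyUnivalentOn f E
  map_zero : f 0 = 0
  deriv_zero_pos : ∃ a : ℝ, 0 < a ∧ deriv f 0 = (a : ℂ)

/-- `P[g](ξ) = (1 / 2πi) ∫_{∂D} g(z) (z + ξ) / (z - ξ) dz / z`, where `∂D` is the unit circle. -/
def schwarzP (g : ℂ → ℂ) (ξ : ℂ) : ℂ :=
  (2 * (Real.pi : ℂ) * Complex.I)⁻¹ * ∮ z in C(0, 1), g z * ((z + ξ) / (z - ξ)) / z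

/-- The right-hand side `ξ f'(ξ) P[1 / |f'|²](ξ)` of the evolution equation. -/
def pgRHS (f : ℂ → ℂ) (ξ : ℂ) : ℂ :=
  ξ * deriv f ξ * schwarzP (fun z => ((1 / ‖deriv f z‖ ^ 2 : ℝ) : ℂ)) ξ

/-- `f` is a strong* solution of `f_t = ξ f' P[1 / |f'|²]` on the time interval `I`: at each time
it belongs to `ω` of the closed unit disk, it is continuously differentiable in time, and it
satisfies the equation in the open unit disk. (`f t ξ` stands for `f(ξ, t)`.) -/
structure IsStrongStarSolution (I : Set ℝ) (f : ℝ → ℂ → ℂ) : Prop where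
  memOmega : ∀ t ∈ I, MemOmega (Metric.closedBall 0 1) (f t)
  contDiffOn : ∀ ξ ∈ Metric.closedBall (0 : ℂ) 1, ContDiffOn ℝ 1 (fun t => f t ξ) I
  equation : ∀ t ∈ I, ∀ ξ ∈ Metric.ball (0 : ℂ) 1,
    HasDerivWithinAt (fun s => f s ξ) (pgRHS (f t) ξ) I t

/-- `f ∈ C¹(I, H(U))` for a time interval `I` and an open set `U`, where `H(U)`, the space of
analytic functions on `U`, carries the topology of locally uniform convergence. -/
def IsC1Holomorphic (I : Set ℝ) (U : Set ℂ) (f : ℝ → ℂ → ℂ) : Prop :=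
  (∀ t ∈ I, AnalyticOnNhd ℂ (f t) U) ∧
    ∃ g : ℝ → ℂ → ℂ,
      (∀ t ∈ I, AnalyticOnNhd ℂ (g t) U) ∧
      (∀ t ∈ I, TendstoLocallyUniformlyOn
        (fun (s : ℝ) (ξ : ℂ) => (f s ξ - f t ξ) / ((s - t : ℝ) : ℂ)) (g t) (𝓝[I \ {t}] t) U) ∧
      (∀ t ∈ I, TendstoLocallyUniformlyOn g (g t) (𝓝[I] t) U)

end

/-! Put w = 1/f'. The equation turns into the pair f_t = f' ξP, w_t = w' ξP - w (ξP)', with P =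
P[|w|²]. No division is left: the right-hand sides are built from products, ∂/∂ξ and the map (u, v)
↦ P[u conj v]. On Taylor coefficients that map is `schwarzPair`, and it is bounded in the weighted
norm ∑ |uₙ| sⁿ for every s ≥ 1 (`WBound.schwarzPair`). Only ∂/∂ξ loses something: a factor 1/(s' -
s) when the radius shrinks from s' to s (`WBound.derivative`). This is the setting of
Cauchy–Kovalevskaya.

The solution is sought as a power series in t whose coefficients are power series in ξ. It exists
formally (`exists_formal_solution`), and its j-th coefficients have norm at most A_j (R - s)^(-j) at
radius s < R, where A solves a cubic convolution recursion (`wBound_coeff_formal_solution`). Since A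
grows at most geometrically (`exists_majorant`), the series converges for small t on a disc of some
radius s > r.

The formal identity f' w = 1 holds because q = f' w solves q_t = ξP q' with q = 1 initially
(`xiDeriv_mul_eq_one`). It shows that f' has no zeros, so f(·,t) is locally univalent, and that |w|²
is 1/|f'|². The Schwarz formula `schwarzP_eq_of_re` identifies the formal P with the integral.
Finally w(0,t) has real Taylor coefficients in t and no zeros, so it stays positive, and so does
f'(0,t). -/

open scoped PowerSeries ComplexConjugate

/-! ### Weighted ℓ¹ norms of power series. -/

namespace PolubarinovaGalin

/-- The `ℓ¹` norm of the power series `u` with weights `s ^ n` is at most `C`. -/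
def WBound (s : ℝ) (u : ℂ⟦X⟧) (C : ℝ) : Prop :=
  ∀ K, ∑ n ∈ Finset.range K, ‖PowerSeries.coeff n u‖ * s ^ n ≤ C

/-- The sum of a power series at a point. -/
noncomputable def ev (u : ℂ⟦X⟧) (ξ : ℂ) : ℂ := ∑' n, PowerSeries.coeff n u * ξ ^ n

/-- The power series `h₀ + 2 ∑ hₖ Xᵏ`, where `∑ hₖ zᵏ` is the Fourier series of `u * conj v` on
the unit circle. -/
noncomputable def schwarzPair (u v : ℂ⟦X⟧) : ℂ⟦X⟧ :=
  PowerSeries.mk fun k => (if k = 0 then 1 else 2) *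
    ∑' m, PowerSeries.coeff (m + k) u * conj (PowerSeries.coeff m v)

/-- The pairs with sum below K form a subset of the square of side K. Working with partial sums
makes norm bounds free of convergence questions. -/
theorem sum_range_antidiagonal_le {a b : ℕ → ℝ} (ha : ∀ n, 0 ≤ a n) (hb : ∀ n, 0 ≤ b n) (K : ℕ) :
    ∑ n ∈ Finset.range K, ∑ p ∈ Finset.HasAntidiagonal.antidiagonal n, a p.1 * b p.2 ≤
      (∑ n ∈ Finset.range K, a n) * ∑ n ∈ Finset.range K, b n := by
  rw [Finset.sum_mul_sum, ← Finset.sum_product', Finset.sum_sigma']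
  refine le_trans (le_of_eq ?_) (Finset.sum_le_sum_of_subset_of_nonneg
    (s := (Finset.range K ×ˢ Finset.range K).filter fun p => p.1 + p.2 < K)
    (Finset.filter_subset _ _) fun p _ _ => mul_nonneg (ha _) (hb _))
  refine Finset.sum_nbij' (fun x => x.2) (fun p => ⟨p.1 + p.2, p⟩) ?_ ?_ ?_ ?_ ?_
  · rintro ⟨n, p⟩ h
    simp only [Finset.mem_sigma, Finset.mem_range, Finset.HasAntidiagonal.mem_antidiagonal,
      Finset.mem_filter,
      Finset.mem_product] at h ⊢
    omega
  · rintro p h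
    simp only [Finset.mem_sigma, Finset.mem_range, Finset.HasAntidiagonal.mem_antidiagonal,
      Finset.mem_filter,
      Finset.mem_product] at h ⊢
    exact ⟨h.2, trivial⟩
  · rintro ⟨n, p⟩ h
    simp only [Finset.mem_sigma, Finset.HasAntidiagonal.mem_antidiagonal] at h
    obtain ⟨-, rfl⟩ := h
    rfl
  · intros; rfl
  · intros; rfl

namespace WBound

variable {s s' C C' : ℝ} {u v : ℂ⟦X⟧}

theorem nonneg (h : WBound s u C) : 0 ≤ C := by simpa using h 0

theorem mono_const (h : WBound s u C) (hC : C ≤ C') : WBound s u C' := fun K => (h K).trans hC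

theorem mono (h : WBound s' u C) (hs : 0 ≤ s) (hss : s ≤ s') : WBound s u C := fun K =>
  le_trans (Finset.sum_le_sum fun n _ => by gcongr) (h K)

theorem summable (h : WBound s u C) (hs : 0 ≤ s) :
    Summable fun n => ‖PowerSeries.coeff n u‖ * s ^ n :=
  summable_of_sum_range_le (fun _ => by positivity) h

theorem tsum_le (h : WBound s u C) (hs : 0 ≤ s) :
    ∑' n, ‖PowerSeries.coeff n u‖ * s ^ n ≤ C :=
  Real.tsum_le_of_sum_range_le (fun _ => by positivity) h

theorem zero : WBound s 0 0 := fun K => by simp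

theorem add (hu : WBound s u C) (hv : WBound s v C') (hs : 0 ≤ s) : WBound s (u + v) (C + C') := by
  intro K
  refine le_trans ?_ (add_le_add (hu K) (hv K))
  rw [← Finset.sum_add_distrib]
  gcongr with n
  rw [← add_mul, map_add]
  gcongr
  exact norm_add_le _ _

theorem neg (hu : WBound s u C) : WBound s (-u) C := by
  intro K
  simpa using hu K

theorem sub (hu : WBound s u C) (hv : WBound s v C') (hs : 0 ≤ s) : WBound s (u - v) (C + C') := by
  rw [sub_eq_add_neg]
  exact hu.add hv.neg hs

theorem sum {ι : Type*} (S : Finset ι) {x : ι → ℂ⟦X⟧} {c : ι → ℝ}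
    (h : ∀ i ∈ S, WBound s (x i) (c i)) (hs : 0 ≤ s) : WBound s (∑ i ∈ S, x i) (∑ i ∈ S, c i) := by
  classical
  induction S using Finset.induction_on with
  | empty => simpa using zero
  | insert a S ha ih =>
    rw [Finset.sum_insert ha, Finset.sum_insert ha]
    exact (h a (by simp)).add (ih fun i hi => h i (by simp [hi])) hs

theorem mul (hu : WBound s u C) (hv : WBound s v C') (hs : 0 ≤ s) : WBound s (u * v) (C * C') := by
  intro K
  refine le_trans ?_ (mul_le_mul (hu K) (hv K) (Finset.sum_nonneg fun n _ => by positivity)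
    hu.nonneg)
  refine le_trans ?_ (sum_range_antidiagonal_le (fun n => by positivity) (fun n => by positivity) K)
  gcongr with n
  rw [PowerSeries.coeff_mul]
  refine (mul_le_mul_of_nonneg_right (norm_sum_le _ _) (by positivity)).trans ?_
  rw [Finset.sum_mul]
  refine Finset.sum_le_sum fun p hp => ?_
  rw [norm_mul, ← Finset.HasAntidiagonal.mem_antidiagonal.1 hp, pow_add]
  exact le_of_eq (by ring)

theorem X (hs : 0 ≤ s) : WBound s (PowerSeries.X : ℂ⟦X⟧) s := by
  intro K
  rcases le_or_gt K 1 with hK | hK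
  · refine le_trans (Finset.sum_le_sum_of_subset_of_nonneg (t := Finset.range 1) ?_ ?_) ?_
    · simpa only [Finset.range_subset_range] using hK
    · intros; positivity
    · simpa using hs
  · rw [Finset.sum_eq_single_of_mem 1 (by simpa using hK)]
    · simp
    · intro n _ hn
      simp [PowerSeries.coeff_X, hn]

/-- A Cauchy estimate, reduced to (n + 1) sⁿ (s' - s) ≤ s'^(n + 1): factor s'^(n + 1) - s^(n + 1)
and bound each of the n + 1 terms of the cofactor below by sⁿ. -/
theorem derivative (hu : WBound s' u C) (hs : 0 ≤ s) (hss : s < s') :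
    WBound s (d⁄dX ℂ u) (C / (s' - s)) := by
  intro K
  rw [le_div_iff₀ (sub_pos.2 hss), Finset.sum_mul]
  refine le_trans ?_ (hu (K + 1))
  rw [Finset.sum_range_succ']
  refine le_trans ?_ (le_add_of_nonneg_right (by positivity))
  refine Finset.sum_le_sum fun n _ => ?_
  have key : (n + 1 : ℝ) * s ^ n * (s' - s) ≤ s' ^ (n + 1) := by
    have h1 := (Commute.all s' s).geom_sum₂_mul (n + 1)
    have h2 : (n + 1 : ℝ) * s ^ n ≤ ∑ i ∈ Finset.range (n + 1), s' ^ i * s ^ (n + 1 - 1 - i) := by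
      have : ∑ i ∈ Finset.range (n + 1), s ^ n = (n + 1 : ℝ) * s ^ n := by simp
      rw [← this]
      refine Finset.sum_le_sum fun i hi => ?_
      have hi' : i ≤ n := by simpa [Nat.lt_succ_iff] using hi
      calc s ^ n = s ^ i * s ^ (n + 1 - 1 - i) := by rw [← pow_add]; congr 1; omega
        _ ≤ _ := by gcongr
    calc _ ≤ _ := mul_le_mul_of_nonneg_right h2 (sub_pos.2 hss).le
      _ = s' ^ (n + 1) - s ^ (n + 1) := h1
      _ ≤ _ := by have : 0 ≤ s ^ (n + 1) := by positivity
                  linarith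
  rw [PowerSeries.coeff_derivative, norm_mul]
  have : ‖(n + 1 : ℂ)‖ = n + 1 := by
    exact_mod_cast Complex.norm_natCast (n + 1)
  rw [this]
  calc _ = ‖PowerSeries.coeff (n + 1) u‖ * ((n + 1 : ℝ) * s ^ n * (s' - s)) := by ring
    _ ≤ _ := by gcongr

theorem summable_pair (hu : WBound s u C) (hv : WBound s v C') (hs : 1 ≤ s) :
    Summable fun p : ℕ × ℕ => ‖PowerSeries.coeff p.1 u‖ * ‖PowerSeries.coeff p.2 v‖ := by
  have h1 := (hu.mono zero_le_one hs).summable zero_le_one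
  have h2 := (hv.mono zero_le_one hs).summable zero_le_one
  simp only [one_pow, mul_one] at h1 h2
  exact h1.mul_of_nonneg h2 (fun _ => norm_nonneg _) (fun _ => norm_nonneg _)

/-- Taking v in the unweighted norm suffices: conj v only shifts the coefficients of u downwards,
and for s ≥ 1 such a shift does not increase the weighted norm. No radius is lost. -/
theorem schwarzPair (hu : WBound s u C) (hv : WBound s v C') (hs : 1 ≤ s) :
    WBound s (schwarzPair u v) (2 * (C * C')) := by
  intro K
  have hs0 : 0 ≤ s := zero_le_one.trans hs
  have hsum : ∀ k, Summable fun m => ‖PowerSeries.coeff (m + k) u‖ * ‖PowerSeries.coeff m v‖ :=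
    fun k => (hu.summable_pair hv hs).comp_injective (i := fun m : ℕ => (m + k, m))
      fun a b h => (Prod.ext_iff.1 h).2
  have hv1 := hv.mono zero_le_one hs
  have hv2 := hv1.summable zero_le_one
  have hv3 := hv1.tsum_le zero_le_one
  simp only [one_pow, mul_one] at hv2 hv3
  calc ∑ k ∈ Finset.range K, ‖PowerSeries.coeff k (PolubarinovaGalin.schwarzPair u v)‖ * s ^ k
      ≤ ∑ k ∈ Finset.range K, 2 *
        ∑' m, ‖PowerSeries.coeff (m + k) u‖ * ‖PowerSeries.coeff m v‖ * s ^ k := by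
        refine Finset.sum_le_sum fun k _ => ?_
        rw [PolubarinovaGalin.schwarzPair, PowerSeries.coeff_mk, norm_mul, tsum_mul_right,
          ← mul_assoc]
        gcongr
        · split_ifs <;> simp
        · refine tsum_of_norm_bounded (hsum k).hasSum fun m => ?_
          simp
    _ = 2 * ∑' m, ∑ k ∈ Finset.range K,
        ‖PowerSeries.coeff (m + k) u‖ * ‖PowerSeries.coeff m v‖ * s ^ k := by
        rw [← Finset.mul_sum, Summable.tsum_finsetSum fun k _ => (hsum k).mul_right _]
    _ ≤ 2 * ∑' m, C * ‖PowerSeries.coeff m v‖ := by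
        gcongr with m
        · exact summable_sum fun k _ => (hsum k).mul_right _
        · exact hv2.mul_left C
        -- Here s ≥ 1 enters, through s ^ k ≤ s ^ (m + k).
        · have : ∑ k ∈ Finset.range K, ‖PowerSeries.coeff (m + k) u‖ * s ^ k ≤ C := by
            refine le_trans ?_ (hu (m + K))
            rw [Finset.sum_range_add]
            refine le_trans ?_ (le_add_of_nonneg_left (by positivity))
            gcongr
            omega
          calc _ = (∑ k ∈ Finset.range K, ‖PowerSeries.coeff (m + k) u‖ * s ^ k) *
                ‖PowerSeries.coeff m v‖ := by
                rw [Finset.sum_mul]; exact Finset.sum_congr rfl fun _ _ => by ring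
            _ ≤ _ := by gcongr
    _ ≤ 2 * (C * C') := by
        rw [tsum_mul_left]
        have := hu.nonneg
        gcongr

end WBound

/-! ### Sums of power series as analytic functions. -/

section Evaluation

variable {s s' C C' : ℝ} {u v : ℂ⟦X⟧} {ξ : ℂ}

theorem norm_coeff_mul_pow_le (hξ : ‖ξ‖ ≤ s) (n : ℕ) :
    ‖PowerSeries.coeff n u * ξ ^ n‖ ≤ ‖PowerSeries.coeff n u‖ * s ^ n := by
  rw [norm_mul, norm_pow]
  gcongr

theorem WBound.summable_norm_ev (hu : WBound s u C) (hξ : ‖ξ‖ ≤ s) :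
    Summable fun n => ‖PowerSeries.coeff n u * ξ ^ n‖ :=
  (hu.summable ((norm_nonneg ξ).trans hξ)).of_nonneg_of_le (fun _ => norm_nonneg _)
    (norm_coeff_mul_pow_le hξ)

theorem WBound.norm_ev_le (hu : WBound s u C) (hξ : ‖ξ‖ ≤ s) : ‖ev u ξ‖ ≤ C :=
  (tsum_of_norm_bounded (hu.summable ((norm_nonneg ξ).trans hξ)).hasSum
    (norm_coeff_mul_pow_le hξ)).trans (hu.tsum_le ((norm_nonneg ξ).trans hξ))

theorem ev_zero_right (u : ℂ⟦X⟧) : ev u 0 = PowerSeries.coeff 0 u := by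
  rw [ev, tsum_eq_single 0 fun n hn => by simp [hn]]
  simp

theorem ev_zero : ev 0 ξ = 0 := by simp [ev]

theorem ev_one : ev 1 ξ = 1 := by
  rw [ev, tsum_eq_single 0 fun n hn => by simp [PowerSeries.coeff_one, hn]]
  simp

theorem ev_X : ev PowerSeries.X ξ = ξ := by
  rw [ev, tsum_eq_single 1 fun n hn => by simp [PowerSeries.coeff_X, hn]]
  simp

theorem ev_add (hu : WBound s u C) (hv : WBound s v C') (hξ : ‖ξ‖ ≤ s) :
    ev (u + v) ξ = ev u ξ + ev v ξ := by
  rw [ev, ev, ev, ← (hu.summable_norm_ev hξ).of_norm.tsum_add (hv.summable_norm_ev hξ).of_norm]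
  simp [add_mul]

theorem ev_sum {ι : Type*} (S : Finset ι) {x : ι → ℂ⟦X⟧} {c : ι → ℝ}
    (h : ∀ i ∈ S, WBound s (x i) (c i)) (hξ : ‖ξ‖ ≤ s) :
    ev (∑ i ∈ S, x i) ξ = ∑ i ∈ S, ev (x i) ξ := by
  classical
  induction S using Finset.induction_on with
  | empty => simp [ev_zero]
  | insert a S ha ih =>
    have hS : ∀ i ∈ S, WBound s (x i) (c i) := fun i hi => h i (by simp [hi])
    rw [Finset.sum_insert ha, Finset.sum_insert ha, ← ih hS]
    exact ev_add (h a (by simp)) (WBound.sum S hS ((norm_nonneg ξ).trans hξ)) hξ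

theorem ev_mul (hu : WBound s u C) (hv : WBound s v C') (hξ : ‖ξ‖ ≤ s) :
    ev (u * v) ξ = ev u ξ * ev v ξ := by
  rw [ev, ev, ev, tsum_mul_tsum_eq_tsum_sum_antidiagonal_of_summable_norm
    (hu.summable_norm_ev hξ) (hv.summable_norm_ev hξ)]
  refine tsum_congr fun n => ?_
  rw [PowerSeries.coeff_mul, Finset.sum_mul]
  refine Finset.sum_congr rfl fun p hp => ?_
  rw [← Finset.HasAntidiagonal.mem_antidiagonal.1 hp, pow_add]
  ring

theorem conj_ev (u : ℂ⟦X⟧) (ξ : ℂ) :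
    conj (ev u ξ) = ev (PowerSeries.map (starRingEnd ℂ) u) (conj ξ) := by
  rw [ev, ev, Complex.conj_tsum]
  simp

theorem WBound.map_conj (hu : WBound s u C) :
    WBound s (PowerSeries.map (starRingEnd ℂ) u) C := by
  intro K
  simpa using hu K

theorem WBound.differentiableOn_ev (hu : WBound s u C) :
    DifferentiableOn ℂ (ev u) (Metric.ball 0 s) := by
  rcases le_or_gt s 0 with hs | hs
  · simpa [Metric.ball_eq_empty.2 hs] using differentiableOn_empty
  refine Complex.differentiableOn_tsum_of_summable_norm (hu.summable hs.le) (fun n => by fun_prop)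
    Metric.isOpen_ball fun n w hw => norm_coeff_mul_pow_le ?_ n
  simpa using (Metric.mem_ball.1 hw).le

theorem WBound.hasDerivAt_ev (hu : WBound s u C) (hξ : ‖ξ‖ < s) :
    HasDerivAt (ev u) (ev (d⁄dX ℂ u) ξ) ξ := by
  have hs : 0 < s := (norm_nonneg ξ).trans_lt hξ
  have hmem : ξ ∈ Metric.ball (0 : ℂ) s := by simpa using hξ
  have h1 := (hu.differentiableOn_ev.differentiableAt
    (Metric.isOpen_ball.mem_nhds hmem)).hasDerivAt
  have h2 := Complex.hasSum_deriv_of_summable_norm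
    (F := fun n (w : ℂ) => PowerSeries.coeff n u * w ^ n) (hu.summable hs.le)
    (fun n => by fun_prop) Metric.isOpen_ball
    (fun n w hw => norm_coeff_mul_pow_le (by simpa using (Metric.mem_ball.1 hw).le) n) hmem
  rw [← hasSum_nat_add_iff' 1] at h2
  have h3 : deriv (ev u) ξ - ∑ i ∈ Finset.range 1,
      deriv (fun w : ℂ => PowerSeries.coeff i u * w ^ i) ξ = deriv (ev u) ξ := by simp
  have h4 : ev (d⁄dX ℂ u) ξ = deriv (ev u) ξ := by
    rw [← h3]
    refine Eq.trans (tsum_congr fun n => ?_) h2.tsum_eq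
    simp [PowerSeries.coeff_derivative, mul_assoc]
  rwa [h4]

theorem WBound.deriv_ev (hu : WBound s u C) (hξ : ‖ξ‖ < s) :
    deriv (ev u) ξ = ev (d⁄dX ℂ u) ξ := (hu.hasDerivAt_ev hξ).deriv

/-- The derivative of the series vanishes too, on a disc of half the radius; hence the induction on
n runs over all series and radii at once. -/
theorem coeff_eq_zero_of_ev_eq_zero (n : ℕ) : ∀ {u : ℂ⟦X⟧} {s C : ℝ}, 0 < s → WBound s u C →
    (∀ ξ, ‖ξ‖ < s → ev u ξ = 0) → PowerSeries.coeff n u = 0 := by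
  induction n with
  | zero =>
    intro u s C hs _ h
    rw [← ev_zero_right]
    exact h 0 (by simpa using hs)
  | succ n ih =>
    intro u s C hs hu h
    have h0 := ih (u := d⁄dX ℂ u) (half_pos hs) (hu.derivative (half_pos hs).le (half_lt_self hs))
      fun ξ hξ => by
        have hξs : ‖ξ‖ < s := hξ.trans (half_lt_self hs)
        rw [← hu.deriv_ev hξs]
        have : ev u =ᶠ[𝓝 ξ] fun _ => 0 := by
          filter_upwards [Metric.isOpen_ball.mem_nhds (show ξ ∈ Metric.ball (0 : ℂ) s by
            simpa using hξs)] with w hw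
          exact h w (by simpa using hw)
        rw [this.deriv_eq, deriv_const]
    rw [PowerSeries.coeff_derivative] at h0
    exact (mul_eq_zero.1 h0).resolve_right (by exact_mod_cast n.succ_ne_zero)

theorem eq_of_ev_eq (hs : 0 < s) (hu : WBound s u C) (hv : WBound s v C')
    (h : ∀ ξ, ‖ξ‖ < s → ev u ξ = ev v ξ) : u = v := by
  rw [← sub_eq_zero]
  ext n
  refine coeff_eq_zero_of_ev_eq_zero n hs (hu.sub hv hs.le) fun ξ hξ => ?_
  rw [sub_eq_add_neg, ev_add hu hv.neg hξ.le, h ξ hξ]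
  simp [ev, tsum_neg]

theorem exists_powerSeries {f : ℂ → ℂ} {R : ℝ} (hR : 0 < R)
    (hf : DifferentiableOn ℂ f (Metric.closedBall 0 R)) :
    ∃ u : ℂ⟦X⟧, (∀ s, 0 ≤ s → s < R → ∃ C, WBound s u C) ∧ ∀ ξ, ‖ξ‖ < R → ev u ξ = f ξ := by
  lift R to NNReal using hR.le
  have hp := hf.hasFPowerSeriesOnBall (by exact_mod_cast hR)
  set p := cauchyPowerSeries f 0 R
  refine ⟨PowerSeries.mk fun n => p.coeff n, fun s hs hsR => ?_, fun ξ hξ => ?_⟩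
  · lift s to NNReal using hs
    have hsum := p.summable_norm_mul_pow
      (lt_of_lt_of_le (by exact_mod_cast hsR) hp.r_le : (s : ENNReal) < p.radius)
    refine ⟨∑' n, ‖p n‖ * (s : ℝ) ^ n, fun K => ?_⟩
    refine le_trans (le_of_eq ?_) (hsum.sum_le_tsum (Finset.range K) fun n _ => by positivity)
    simp [p.norm_apply_eq_norm_coef]
  · have := hp.hasSum (y := ξ) (by simpa [← NNReal.coe_lt_coe, enorm, nnnorm] using hξ)
    rw [zero_add] at this
    rw [← this.tsum_eq, ev]
    refine tsum_congr fun n => ?_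
    rw [FormalMultilinearSeries.apply_eq_pow_smul_coeff, PowerSeries.coeff_mk, smul_eq_mul,
      mul_comm]

end Evaluation

/-! ### Splitting a product u conj v on the unit circle. -/

section Circle

/-- The quadrant splits into lines parallel to the diagonal. Each off-diagonal line occurs in one of
the two sums, with weight 2; the diagonal occurs in both, with weight 1. -/
theorem two_mul_tsum_eq {a : ℕ × ℕ → ℂ} (ha : Summable a) :
    2 * ∑' p, a p = (∑' k, (if k = 0 then 1 else 2) * ∑' m, a (m + k, m)) +
      ∑' k, (if k = 0 then 1 else 2) * ∑' m, a (m, m + k) := by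
  have hi₁ : Function.Injective fun p : ℕ × ℕ => (p.2 + p.1, p.2) := by
    rintro ⟨k, m⟩ ⟨k', m'⟩ h
    simp only [Prod.mk.injEq] at h ⊢
    omega
  have hi₂ : Function.Injective fun p : ℕ × ℕ => (p.2, p.2 + p.1) := by
    rintro ⟨k, m⟩ ⟨k', m'⟩ h
    simp only [Prod.mk.injEq] at h ⊢
    omega
  have hi₃ : Function.Injective fun p : ℕ × ℕ => (p.2, p.2 + (p.1 + 1)) := by
    rintro ⟨k, m⟩ ⟨k', m'⟩ h
    simp only [Prod.mk.injEq] at h ⊢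
    omega
  have hs₁ := ha.comp_injective hi₁
  have hs₂ := ha.comp_injective hi₂
  have hs₃ := ha.comp_injective hi₃
  have hc : IsCompl (range fun p : ℕ × ℕ => (p.2 + p.1, p.2))
      (range fun p : ℕ × ℕ => (p.2, p.2 + (p.1 + 1))) := by
    rw [isCompl_iff, disjoint_left, codisjoint_iff_le_sup]
    refine ⟨?_, ?_⟩
    · rintro _ ⟨⟨k, m⟩, rfl⟩ ⟨⟨k', m'⟩, h⟩
      simp only [Prod.mk.injEq] at h
      omega
    · rintro ⟨n, m⟩ -
      rcases le_or_gt m n with h | h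
      · exact Or.inl ⟨(n - m, m), Prod.ext (Nat.add_sub_of_le h) rfl⟩
      · exact Or.inr ⟨(m - n - 1, n), Prod.ext rfl (by dsimp only; omega)⟩
  have htot : ∑' p, a p = (∑' k, ∑' m, a (m + k, m)) + ∑' k, ∑' m, a (m, m + (k + 1)) := by
    have h1 := (hi₁.hasSum_range_iff (f := a)).2 hs₁.hasSum
    have h3 := (hi₃.hasSum_range_iff (f := a)).2 hs₃.hasSum
    rw [(h1.add_isCompl hc h3).tsum_eq, hs₁.tsum_prod, hs₃.tsum_prod]
    rfl
  have hx₁ : Summable fun k => ∑' m, a (m + k, m) := hs₁.prod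
  have hx₂ : Summable fun k => ∑' m, a (m, m + k) := hs₂.prod
  have hw : ∀ {x : ℕ → ℂ}, Summable x →
      ∑' k, (if k = 0 then 1 else 2) * x k = x 0 + 2 * ∑' k, x (k + 1) := by
    intro x hx
    have hx' : Summable fun k => (if k = 0 then 1 else 2) * x k := by
      rw [← summable_nat_add_iff 1]
      simpa using ((summable_nat_add_iff 1).2 hx).mul_left 2
    rw [hx'.tsum_eq_zero_add]
    simp [tsum_mul_left]
  rw [htot, hw hx₁, hw hx₂, hx₁.tsum_eq_zero_add]
  simp only [add_zero]
  ring

variable {s C C' : ℝ} {u v : ℂ⟦X⟧} {z : ℂ}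

/-- On the unit circle, `2 u (conj v)` splits into an analytic and an antianalytic part. -/
theorem two_mul_ev_mul_conj_ev (hs : 1 ≤ s) (hu : WBound s u C) (hv : WBound s v C')
    (hz : ‖z‖ = 1) :
    2 * (ev u z * conj (ev v z)) = ev (schwarzPair u v) z + conj (ev (schwarzPair v u) z) := by
  have hzz : z * conj z = 1 := by rw [Complex.mul_conj, Complex.normSq_eq_norm_sq, hz]; simp
  have hnu := hu.summable_norm_ev (ξ := z) (by rw [hz]; exact hs)
  have hnv := hv.summable_norm_ev (ξ := z) (by rw [hz]; exact hs)
  have hnv' : Summable fun n => ‖conj (PowerSeries.coeff n v * z ^ n)‖ := by simpa using hnv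
  have hmul : ev u z * conj (ev v z) = ∑' p : ℕ × ℕ,
      (PowerSeries.coeff p.1 u * z ^ p.1) * conj (PowerSeries.coeff p.2 v * z ^ p.2) := by
    rw [ev, ev, Complex.conj_tsum, tsum_mul_tsum_of_summable_norm hnu hnv']
  have hpow : ∀ m : ℕ, z ^ m * conj z ^ m = 1 := fun m => by rw [← mul_pow, hzz, one_pow]
  rw [hmul, two_mul_tsum_eq (summable_mul_of_summable_norm hnu hnv'), ev, ev, Complex.conj_tsum]
  congr 1
  · refine tsum_congr fun k => ?_
    rw [schwarzPair, PowerSeries.coeff_mk, mul_assoc, ← tsum_mul_right]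
    congr 1
    refine tsum_congr fun m => ?_
    simp only [map_mul, map_pow]
    rw [pow_add]
    linear_combination (PowerSeries.coeff (m + k) u * conj (PowerSeries.coeff m v) * z ^ k) * hpow m
  · refine tsum_congr fun k => ?_
    rw [schwarzPair, PowerSeries.coeff_mk, mul_assoc, ← tsum_mul_right, map_mul, Complex.conj_tsum]
    congr 1
    · split_ifs
      · exact (map_one _).symm
      · exact (Complex.conj_ofNat 2).symm
    refine tsum_congr fun m => ?_
    simp only [map_mul, map_pow, Complex.conj_conj]
    rw [pow_add]
    linear_combination (PowerSeries.coeff m u * conj (PowerSeries.coeff (m + k) v) * conj z ^ k) *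
      hpow m

theorem coeff_zero_schwarzPair_comm (u v : ℂ⟦X⟧) :
    conj (PowerSeries.coeff 0 (schwarzPair u v)) = PowerSeries.coeff 0 (schwarzPair v u) := by
  simp [schwarzPair, Complex.conj_tsum, mul_comm]

end Circle

/-! ### Recursive sequences and the scalar majorant. -/

section Recursion

/-- Course-of-values recursion: `y n` is a full sequence whose entries up to n are final, and the
solution is the diagonal `y i i`. -/
theorem exists_seq_rec {α : Type*} (a : α) (Φ : (ℕ → α) → ℕ → α)
    (hΦ : ∀ x y j, (∀ i ≤ j, x i = y i) → Φ x j = Φ y j) :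
    ∃ x : ℕ → α, x 0 = a ∧ ∀ j, x (j + 1) = Φ x j := by
  let y : ℕ → ℕ → α := fun n => Nat.rec (fun _ => a)
    (fun j z => Function.update z (j + 1) (Φ z j)) n
  have hy : ∀ j, y (j + 1) = Function.update (y j) (j + 1) (Φ (y j) j) := fun _ => rfl
  have hstable : ∀ i k, y (i + k) i = y i i := by
    intro i k
    induction k with
    | zero => rfl
    | succ k ih =>
      rw [← add_assoc, hy, Function.update_of_ne (by omega), ih]
  refine ⟨fun i => y i i, rfl, fun j => ?_⟩
  simp only [hy, Function.update_self]
  refine hΦ _ _ j fun i hi => ?_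
  obtain ⟨k, rfl⟩ := Nat.exists_eq_add_of_le hi
  exact hstable i k

/-- The Cauchy product of two sequences. -/
def conv (a b : ℕ → ℝ) (n : ℕ) : ℝ :=
  ∑ p ∈ Finset.HasAntidiagonal.antidiagonal n, a p.1 * b p.2

theorem conv_congr {a b a' b' : ℕ → ℝ} {n : ℕ} (ha : ∀ i ≤ n, a i = a' i)
    (hb : ∀ i ≤ n, b i = b' i) : conv a b n = conv a' b' n := by
  refine Finset.sum_congr rfl fun p hp => ?_
  have := Finset.HasAntidiagonal.mem_antidiagonal.1 hp
  rw [ha p.1 (by omega), hb p.2 (by omega)]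

theorem conv_nonneg {a b : ℕ → ℝ} (ha : ∀ n, 0 ≤ a n) (hb : ∀ n, 0 ≤ b n) (n : ℕ) :
    0 ≤ conv a b n := Finset.sum_nonneg fun _ _ => mul_nonneg (ha _) (hb _)

theorem conv_mul_pow (a b : ℕ → ℝ) (τ : ℝ) (n : ℕ) :
    conv (fun i => a i * τ ^ i) (fun i => b i * τ ^ i) n = conv a b n * τ ^ n := by
  rw [conv, conv, Finset.sum_mul]
  refine Finset.sum_congr rfl fun p hp => ?_
  rw [← Finset.HasAntidiagonal.mem_antidiagonal.1 hp, pow_add]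
  ring

theorem conv_const_mul (a b : ℕ → ℝ) (c d : ℝ) (n : ℕ) :
    conv (fun i => c * a i) (fun i => d * b i) n = c * d * conv a b n := by
  rw [conv, conv, Finset.mul_sum]
  exact Finset.sum_congr rfl fun p _ => by ring

theorem sum_range_conv_mul_pow_le {a b : ℕ → ℝ} {τ : ℝ} (ha : ∀ n, 0 ≤ a n) (hb : ∀ n, 0 ≤ b n)
    (hτ : 0 ≤ τ) (K : ℕ) : ∑ n ∈ Finset.range K, conv a b n * τ ^ n ≤
      (∑ n ∈ Finset.range K, a n * τ ^ n) * ∑ n ∈ Finset.range K, b n * τ ^ n := by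
  simp_rw [← conv_mul_pow]
  exact sum_range_antidiagonal_le (fun n => mul_nonneg (ha n) (by positivity))
    (fun n => mul_nonneg (hb n) (by positivity)) K

/-- The cubic recursion has a solution with positive radius of convergence. -/
theorem exists_majorant {M c : ℝ} (hM : 0 < M) (hc : 0 < c) :
    ∃ A : ℕ → ℝ, A 0 = M ∧ (∀ j, A (j + 1) = c * conv A (conv A A) j) ∧ (∀ j, 0 ≤ A j) ∧
      ∃ τ, 0 < τ ∧ ∀ K, ∑ j ∈ Finset.range K, A j * τ ^ j ≤ 2 * M := by
  obtain ⟨A, hA0, hA⟩ := exists_seq_rec M (fun A j => c * conv A (conv A A) j) (by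
    intro x y j h
    rw [conv_congr h fun i hi => conv_congr (fun k hk => h k (hk.trans hi))
      fun k hk => h k (hk.trans hi)])
  have hnn : ∀ j, 0 ≤ A j := by
    intro j
    induction j using Nat.strong_induction_on with
    | _ j ih =>
      rcases j with _ | j
      · rw [hA0]; exact hM.le
      · rw [hA]
        refine mul_nonneg hc.le (Finset.sum_nonneg fun p hp => mul_nonneg (ih _ ?_)
          (Finset.sum_nonneg fun q hq => mul_nonneg (ih _ ?_) (ih _ ?_)))
        all_goals have := Finset.HasAntidiagonal.mem_antidiagonal.1 hp
        · omega
        all_goals have := Finset.HasAntidiagonal.mem_antidiagonal.1 hq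
        all_goals omega
  -- This τ solves c τ (2M)³ = M, so a partial sum at most 2M yields a next one at most M + M.
  refine ⟨A, hA0, hA, hnn, 1 / (8 * c * M ^ 2), by positivity, fun K => ?_⟩
  set τ := 1 / (8 * c * M ^ 2) with hτ
  have hτ0 : 0 < τ := by positivity
  induction K with
  | zero => simpa using hM.le
  | succ K ih =>
    have hS : 0 ≤ ∑ j ∈ Finset.range K, A j * τ ^ j :=
      Finset.sum_nonneg fun j _ => mul_nonneg (hnn j) (by positivity)
    have h1 := sum_range_conv_mul_pow_le hnn (conv_nonneg hnn hnn) hτ0.le K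
    have h2 := sum_range_conv_mul_pow_le hnn hnn hτ0.le K
    have h3 : ∑ n ∈ Finset.range K, conv A (conv A A) n * τ ^ n ≤ (2 * M) * ((2 * M) * (2 * M)) :=
      h1.trans (mul_le_mul ih (h2.trans (mul_le_mul ih ih hS (by positivity)))
        (Finset.sum_nonneg fun j _ => mul_nonneg (conv_nonneg hnn hnn j) (by positivity))
        (by positivity))
    rw [Finset.sum_range_succ', hA0]
    have h4 : ∑ j ∈ Finset.range K, A (j + 1) * τ ^ (j + 1) =
        c * τ * ∑ n ∈ Finset.range K, conv A (conv A A) n * τ ^ n := by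
      rw [Finset.mul_sum]
      exact Finset.sum_congr rfl fun j _ => by rw [hA, pow_succ]; ring
    have h5 : c * τ * ((2 * M) * ((2 * M) * (2 * M))) = M := by
      rw [hτ]; field_simp; ring
    have h6 : c * τ * ∑ n ∈ Finset.range K, conv A (conv A A) n * τ ^ n ≤ M := by
      rw [← h5]
      gcongr
    rw [h4, pow_zero]
    linarith

end Recursion

/-! ### The formal solution and its algebraic identities. -/

section Formal

theorem coeff_zero_mul {R : Type*} [CommRing R] (x y : R⟦X⟧) :
    PowerSeries.coeff 0 (x * y) = PowerSeries.coeff 0 x * PowerSeries.coeff 0 y := by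
  simp

theorem derivative_mul {R : Type*} [CommRing R] (x y : R⟦X⟧) :
    d⁄dX R (x * y) = x * d⁄dX R y + y * d⁄dX R x := Derivation.leibniz _ x y

theorem natCast_add_one_ne_zero (j : ℕ) : (j : ℂ⟦X⟧) + 1 ≠ 0 := by
  intro h
  have h1 := congrArg PowerSeries.constantCoeff h
  simp only [map_add, map_natCast, map_one, map_zero] at h1
  exact j.succ_ne_zero (by exact_mod_cast h1)

/-- Termwise differentiation with respect to the inner variable. -/
noncomputable def xiDeriv (x : ℂ⟦X⟧⟦X⟧) : ℂ⟦X⟧⟦X⟧ :=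
  PowerSeries.mk fun j => d⁄dX ℂ (PowerSeries.coeff j x)

/-- The series `P[|w|²]`, where the outer variable is real. -/
noncomputable def schwarzSeries (w : ℂ⟦X⟧⟦X⟧) : ℂ⟦X⟧⟦X⟧ :=
  PowerSeries.mk fun j => ∑ p ∈ Finset.HasAntidiagonal.antidiagonal j,
    schwarzPair (PowerSeries.coeff p.1 w) (PowerSeries.coeff p.2 w)

/-- The inner variable as a series. -/
noncomputable def xi : ℂ⟦X⟧⟦X⟧ := PowerSeries.C PowerSeries.X

theorem coeff_xiDeriv (j : ℕ) (x : ℂ⟦X⟧⟦X⟧) :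
    PowerSeries.coeff j (xiDeriv x) = d⁄dX ℂ (PowerSeries.coeff j x) := PowerSeries.coeff_mk _ _

theorem coeff_schwarzSeries (j : ℕ) (w : ℂ⟦X⟧⟦X⟧) :
    PowerSeries.coeff j (schwarzSeries w) = ∑ p ∈ Finset.HasAntidiagonal.antidiagonal j,
      schwarzPair (PowerSeries.coeff p.1 w) (PowerSeries.coeff p.2 w) := PowerSeries.coeff_mk _ _

theorem coeff_xi_mul (j : ℕ) (x : ℂ⟦X⟧⟦X⟧) :
    PowerSeries.coeff j (xi * x) = PowerSeries.X * PowerSeries.coeff j x :=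
  PowerSeries.coeff_C_mul _ _ _

theorem xiDeriv_mul (x y : ℂ⟦X⟧⟦X⟧) : xiDeriv (x * y) = x * xiDeriv y + xiDeriv x * y := by
  ext1 j
  simp only [coeff_xiDeriv, map_add, PowerSeries.coeff_mul, map_sum, Derivation.leibniz,
    ← Finset.sum_add_distrib]
  exact Finset.sum_congr rfl fun p _ => by simp only [smul_eq_mul]; ring

theorem xiDeriv_derivative (x : ℂ⟦X⟧⟦X⟧) :
    xiDeriv (d⁄dX ℂ⟦X⟧ x) = d⁄dX ℂ⟦X⟧ (xiDeriv x) := by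
  ext1 j
  simp only [coeff_xiDeriv, PowerSeries.coeff_derivative, Derivation.leibniz]
  have : d⁄dX ℂ ((j : ℂ⟦X⟧) + 1) = 0 := by simp
  rw [this, smul_zero, zero_add, smul_eq_mul, mul_comm]

/-- `x` and `y` have the same coefficients up to order `j`. -/
def AgreeUpTo (j : ℕ) (x y : ℂ⟦X⟧⟦X⟧) : Prop :=
  ∀ i ≤ j, PowerSeries.coeff i x = PowerSeries.coeff i y

namespace AgreeUpTo

variable {j : ℕ} {x y x' y' : ℂ⟦X⟧⟦X⟧}

theorem refl (x : ℂ⟦X⟧⟦X⟧) : AgreeUpTo j x x := fun _ _ => rfl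

theorem mul (h : AgreeUpTo j x x') (h' : AgreeUpTo j y y') : AgreeUpTo j (x * y) (x' * y') := by
  intro i hi
  rw [PowerSeries.coeff_mul, PowerSeries.coeff_mul]
  refine Finset.sum_congr rfl fun p hp => ?_
  have := Finset.HasAntidiagonal.mem_antidiagonal.1 hp
  rw [h p.1 (by omega), h' p.2 (by omega)]

theorem sub (h : AgreeUpTo j x x') (h' : AgreeUpTo j y y') : AgreeUpTo j (x - y) (x' - y') := by
  intro i hi
  rw [map_sub, map_sub, h i hi, h' i hi]

theorem xiDeriv (h : AgreeUpTo j x x') : AgreeUpTo j (xiDeriv x) (xiDeriv x') := by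
  intro i hi
  rw [coeff_xiDeriv, coeff_xiDeriv, h i hi]

theorem schwarzSeries (h : AgreeUpTo j x x') :
    AgreeUpTo j (schwarzSeries x) (schwarzSeries x') := by
  intro i hi
  rw [coeff_schwarzSeries, coeff_schwarzSeries]
  refine Finset.sum_congr rfl fun p hp => ?_
  have := Finset.HasAntidiagonal.mem_antidiagonal.1 hp
  rw [h p.1 (by omega), h p.2 (by omega)]

end AgreeUpTo

/-- The right-hand side of the equation for `f`. -/
noncomputable def rhsF (f w : ℂ⟦X⟧⟦X⟧) : ℂ⟦X⟧⟦X⟧ := xiDeriv f * (xi * schwarzSeries w)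

/-- The right-hand side of the equation for `w = 1 / f'`. -/
noncomputable def rhsW (w : ℂ⟦X⟧⟦X⟧) : ℂ⟦X⟧⟦X⟧ :=
  xiDeriv w * (xi * schwarzSeries w) - w * xiDeriv (xi * schwarzSeries w)

/-- The order-j coefficients of the right-hand sides involve f and w only up to order j, so they
determine order j + 1 after division by j + 1. -/
theorem exists_formal_solution (F W : ℂ⟦X⟧) :
    ∃ f w : ℂ⟦X⟧⟦X⟧, PowerSeries.coeff 0 f = F ∧ PowerSeries.coeff 0 w = W ∧
      d⁄dX ℂ⟦X⟧ f = rhsF f w ∧ d⁄dX ℂ⟦X⟧ w = rhsW w := by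
  obtain ⟨x, hx0, hx⟩ := exists_seq_rec (F, W) (fun (x : ℕ → ℂ⟦X⟧ × ℂ⟦X⟧) j =>
    (PowerSeries.C ((j + 1 : ℂ)⁻¹) * PowerSeries.coeff j
      (rhsF (PowerSeries.mk fun i => (x i).1) (PowerSeries.mk fun i => (x i).2)),
     PowerSeries.C ((j + 1 : ℂ)⁻¹) * PowerSeries.coeff j
      (rhsW (PowerSeries.mk fun i => (x i).2)))) (by
    intro x y j h
    have h1 : AgreeUpTo j (PowerSeries.mk fun i => (x i).1) (PowerSeries.mk fun i => (y i).1) :=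
      fun i hi => by simp [h i hi]
    have h2 : AgreeUpTo j (PowerSeries.mk fun i => (x i).2) (PowerSeries.mk fun i => (y i).2) :=
      fun i hi => by simp [h i hi]
    have h3 := (AgreeUpTo.refl xi).mul h2.schwarzSeries
    simp only [Prod.mk.injEq]
    exact ⟨congrArg _ ((h1.xiDeriv.mul h3) j le_rfl),
      congrArg _ (((h2.xiDeriv.mul h3).sub (h2.mul h3.xiDeriv)) j le_rfl)⟩)
  have hC : ∀ (j : ℕ) (u : ℂ⟦X⟧), PowerSeries.C ((j + 1 : ℂ)⁻¹) * u * ((j : ℂ⟦X⟧) + 1) = u := by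
    intro j u
    have h1 : ((j : ℂ⟦X⟧) + 1) = PowerSeries.C (j + 1 : ℂ) := by simp
    rw [h1, mul_right_comm, ← map_mul, inv_mul_cancel₀ (by exact_mod_cast j.succ_ne_zero), map_one,
      one_mul]
  refine ⟨PowerSeries.mk fun i => (x i).1, PowerSeries.mk fun i => (x i).2, by simp [hx0],
    by simp [hx0], ?_, ?_⟩
  · ext1 j
    rw [PowerSeries.coeff_derivative, PowerSeries.coeff_mk, hx, hC]
  · ext1 j
    rw [PowerSeries.coeff_derivative, PowerSeries.coeff_mk, hx, hC]

/-- A series that solves a transport equation is determined by its initial value. -/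
theorem eq_one_of_transport {q a : ℂ⟦X⟧⟦X⟧} (h0 : PowerSeries.coeff 0 q = 1)
    (h : d⁄dX ℂ⟦X⟧ q = a * xiDeriv q) : q = 1 := by
  have key : ∀ j, PowerSeries.coeff j q = PowerSeries.coeff j 1 := by
    intro j
    induction j using Nat.strong_induction_on with
    | _ j ih =>
      rcases j with _ | j
      · simpa using h0
      · have h1 := congrArg (PowerSeries.coeff j) h
        rw [PowerSeries.coeff_derivative, PowerSeries.coeff_mul] at h1
        -- By induction the coefficients of `q` up to order j are constants in ξ, which `xiDeriv`
        -- kills.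
        have h2 : ∑ p ∈ Finset.HasAntidiagonal.antidiagonal j,
            PowerSeries.coeff p.1 a * PowerSeries.coeff p.2 (xiDeriv q) = 0 := by
          refine Finset.sum_eq_zero fun p hp => ?_
          have := Finset.HasAntidiagonal.mem_antidiagonal.1 hp
          rw [coeff_xiDeriv, ih p.2 (by omega), PowerSeries.coeff_one]
          split_ifs <;> simp
        rw [h2] at h1
        rw [(mul_eq_zero.1 h1).resolve_right (natCast_add_one_ne_zero j)]
        simp [PowerSeries.coeff_one]
  ext1 j
  exact key j

/-- With a = ξP, the product rule gives (f' a)' w + f' (w' a - w a') = a (f' w)': the terms with a'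
cancel and a transport equation remains. -/
theorem xiDeriv_mul_eq_one {f w : ℂ⟦X⟧⟦X⟧}
    (h0 : d⁄dX ℂ (PowerSeries.coeff 0 f) * PowerSeries.coeff 0 w = 1)
    (hf : d⁄dX ℂ⟦X⟧ f = rhsF f w) (hw : d⁄dX ℂ⟦X⟧ w = rhsW w) : xiDeriv f * w = 1 := by
  refine eq_one_of_transport (a := xi * schwarzSeries w) ?_ ?_
  · rw [coeff_zero_mul, coeff_xiDeriv, h0]
  · rw [derivative_mul, ← xiDeriv_derivative, hf, hw, rhsF, rhsW, xiDeriv_mul (xiDeriv f),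
      xiDeriv_mul (xiDeriv f)]
    ring

theorem constantCoeff_coeff_eq_zero {f w : ℂ⟦X⟧⟦X⟧}
    (h0 : PowerSeries.coeff 0 (PowerSeries.coeff 0 f) = 0)
    (hf : d⁄dX ℂ⟦X⟧ f = rhsF f w) (j : ℕ) : PowerSeries.coeff 0 (PowerSeries.coeff j f) = 0 := by
  rcases j with _ | j
  · exact h0
  have h1 := congrArg (PowerSeries.coeff 0 <| PowerSeries.coeff j ·) hf
  simp only [PowerSeries.coeff_derivative, rhsF] at h1
  rw [mul_left_comm, coeff_xi_mul, coeff_zero_mul, coeff_zero_mul] at h1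
  simp only [PowerSeries.coeff_zero_X, zero_mul] at h1
  refine (mul_eq_zero.1 h1).resolve_right ?_
  simpa using (by exact_mod_cast j.succ_ne_zero : (j : ℂ) + 1 ≠ 0)

/-- Conjugation exchanges the two arguments of `schwarzPair` at order 0, and the sum over the
antidiagonal is symmetric. -/
theorem conj_constantCoeff_schwarzSeries (w : ℂ⟦X⟧⟦X⟧) (j : ℕ) :
    conj (PowerSeries.coeff 0 (PowerSeries.coeff j (schwarzSeries w))) =
      PowerSeries.coeff 0 (PowerSeries.coeff j (schwarzSeries w)) := by
  rw [coeff_schwarzSeries, map_sum, map_sum, ← Finset.Nat.sum_antidiagonal_swap]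
  refine Finset.sum_congr rfl fun p _ => ?_
  rw [coeff_zero_schwarzPair_comm]
  rfl

/-- At ξ = 0 the equation for w reads w_t = -w P(0), because ξP vanishes there and has derivative
P(0); this recursion has real data. -/
theorem conj_constantCoeff_coeff {w : ℂ⟦X⟧⟦X⟧}
    (h0 : conj (PowerSeries.coeff 0 (PowerSeries.coeff 0 w)) =
      PowerSeries.coeff 0 (PowerSeries.coeff 0 w))
    (hw : d⁄dX ℂ⟦X⟧ w = rhsW w) (j : ℕ) :
    conj (PowerSeries.coeff 0 (PowerSeries.coeff j w)) =
      PowerSeries.coeff 0 (PowerSeries.coeff j w) := by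
  induction j using Nat.strong_induction_on with
  | _ j ih =>
    rcases j with _ | j
    · exact h0
    have hd : ∀ i, PowerSeries.coeff 0 (PowerSeries.coeff i (xiDeriv (xi * schwarzSeries w))) =
        PowerSeries.coeff 0 (PowerSeries.coeff i (schwarzSeries w)) := by
      intro i
      rw [coeff_xiDeriv, coeff_xi_mul, PowerSeries.coeff_derivative, zero_add,
        mul_comm PowerSeries.X, PowerSeries.coeff_succ_mul_X]
      simp
    have h1 := congrArg (PowerSeries.coeff 0 <| PowerSeries.coeff j ·) hw
    simp only [PowerSeries.coeff_derivative, rhsW, map_sub] at h1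
    rw [mul_left_comm, coeff_xi_mul, coeff_zero_mul, coeff_zero_mul] at h1
    simp only [PowerSeries.coeff_zero_X, zero_mul, zero_sub] at h1
    have h2 : PowerSeries.coeff 0 ((j : ℂ⟦X⟧) + 1) = (j : ℂ) + 1 := by simp
    have hj : (j : ℂ) + 1 ≠ 0 := by exact_mod_cast j.succ_ne_zero
    rw [h2, ← eq_div_iff hj] at h1
    rw [h1, map_div₀, map_neg, PowerSeries.coeff_mul, map_sum, map_sum]
    congr 1
    · congr 1
      refine Finset.sum_congr rfl fun p hp => ?_
      have := Finset.HasAntidiagonal.mem_antidiagonal.1 hp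
      rw [coeff_zero_mul, map_mul, ih p.1 (by omega), hd,
        conj_constantCoeff_schwarzSeries]
    · simp

end Formal

/-! ### Cauchy–Kovalevskaya estimates for the coefficients. -/

section Majorant

variable {s s' : ℝ} {x y : ℂ⟦X⟧⟦X⟧} {c d : ℕ → ℝ} {j : ℕ}

theorem WBound.coeff_mul (hx : ∀ i ≤ j, WBound s (PowerSeries.coeff i x) (c i))
    (hy : ∀ i ≤ j, WBound s (PowerSeries.coeff i y) (d i)) (hs : 0 ≤ s) :
    WBound s (PowerSeries.coeff j (x * y)) (conv c d j) := by
  rw [PowerSeries.coeff_mul]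
  refine WBound.sum _ (fun p hp => ?_) hs
  have := Finset.HasAntidiagonal.mem_antidiagonal.1 hp
  exact (hx p.1 (by omega)).mul (hy p.2 (by omega)) hs

theorem WBound.coeff_schwarzSeries (hx : ∀ i ≤ j, WBound s (PowerSeries.coeff i x) (c i))
    (hs : 1 ≤ s) : WBound s (PowerSeries.coeff j (schwarzSeries x)) (2 * conv c c j) := by
  rw [PolubarinovaGalin.coeff_schwarzSeries, conv, Finset.mul_sum]
  refine WBound.sum _ (fun p hp => ?_) (zero_le_one.trans hs)
  have := Finset.HasAntidiagonal.mem_antidiagonal.1 hp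
  exact (hx p.1 (by omega)).schwarzPair (hx p.2 (by omega)) hs

theorem WBound.of_mul_natCast {u : ℂ⟦X⟧} {B : ℝ} (h : WBound s (u * ((j : ℂ⟦X⟧) + 1)) B) :
    WBound s u (B / (j + 1)) := by
  intro K
  rw [le_div_iff₀ (by positivity), Finset.sum_mul]
  refine le_trans (le_of_eq (Finset.sum_congr rfl fun n _ => ?_)) (h K)
  have h1 : ((j : ℂ⟦X⟧) + 1) = PowerSeries.C (j + 1 : ℂ) := by simp
  have h2 : ‖(j + 1 : ℂ)‖ = j + 1 := by exact_mod_cast Complex.norm_natCast (j + 1)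
  rw [h1, PowerSeries.coeff_mul_C, norm_mul, h2]
  ring

theorem WBound.coeff_xi_mul {u : ℝ} (hx : WBound s (PowerSeries.coeff j x) u) (hs : 0 ≤ s) :
    WBound s (PowerSeries.coeff j (xi * x)) (s * u) := by
  rw [PolubarinovaGalin.coeff_xi_mul]
  exact (WBound.X hs).mul hx hs

theorem WBound.coeff_xiDeriv {u : ℝ} (hx : WBound s' (PowerSeries.coeff j x) u) (hs : 0 ≤ s)
    (hss : s < s') : WBound s (PowerSeries.coeff j (xiDeriv x)) ((s' - s)⁻¹ * u) := by
  rw [PolubarinovaGalin.coeff_xiDeriv, inv_mul_eq_div]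
  exact hx.derivative hs hss

/-- Bounds by e the total cost of applying the induction hypothesis at a slightly larger radius. -/
theorem one_add_inv_pow_le (j : ℕ) : (((j : ℝ) + 2) / (j + 1)) ^ j ≤ 3 := by
  have h1 : ((j : ℝ) + 2) / (j + 1) ≤ Real.exp (1 / (j + 1)) := by
    refine le_trans (le_of_eq ?_) (Real.add_one_le_exp _)
    field_simp
    ring
  calc (((j : ℝ) + 2) / (j + 1)) ^ j ≤ Real.exp (1 / (j + 1)) ^ j := by gcongr
    _ = Real.exp (j * (1 / (j + 1))) := (Real.exp_nat_mul _ _).symm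
    _ ≤ Real.exp 1 := by
      refine Real.exp_le_exp.2 ?_
      rw [mul_one_div, div_le_one (by positivity)]
      linarith
    _ ≤ 3 := Real.exp_one_lt_three.le

variable {R M : ℝ} {f w : ℂ⟦X⟧⟦X⟧} {A : ℕ → ℝ}

/-- Each term has a single ξ-derivative, costing (s' - s)⁻¹, while ξP costs 2s' ≤ 2R. The equation
for w has two such terms, whence 4R. -/
theorem wBound_rhs (hs : 1 ≤ s) (hss : s < s') (hsR : s' ≤ R) (hc : ∀ i, 0 ≤ c i)
    (hf : ∀ i ≤ j, WBound s' (PowerSeries.coeff i f) (c i))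
    (hw : ∀ i ≤ j, WBound s' (PowerSeries.coeff i w) (c i)) :
    WBound s (PowerSeries.coeff j (rhsF f w)) ((s' - s)⁻¹ * (4 * R) * conv c (conv c c) j) ∧
    WBound s (PowerSeries.coeff j (rhsW w)) ((s' - s)⁻¹ * (4 * R) * conv c (conv c c) j) := by
  have hs0 : 0 ≤ s := zero_le_one.trans hs
  have hK := conv_nonneg hc (conv_nonneg hc hc) j
  have hd : 0 ≤ (s' - s)⁻¹ := inv_nonneg.2 (sub_pos.2 hss).le
  have hP : ∀ i ≤ j, WBound s' (PowerSeries.coeff i (xi * schwarzSeries w))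
      (s' * (2 * conv c c i)) := fun i hi =>
    (WBound.coeff_schwarzSeries (fun k hk => hw k (hk.trans hi)) (hs.trans hss.le)).coeff_xi_mul
      (hs0.trans hss.le)
  have hP' : ∀ i ≤ j, WBound s (PowerSeries.coeff i (xi * schwarzSeries w))
      (s' * 2 * conv c c i) := fun i hi => by
    rw [mul_assoc]; exact (hP i hi).mono hs0 hss.le
  have hdP : ∀ i ≤ j, WBound s (PowerSeries.coeff i (xiDeriv (xi * schwarzSeries w)))
      ((s' - s)⁻¹ * (s' * 2) * conv c c i) := fun i hi => by
    rw [mul_assoc, mul_assoc]; exact (hP i hi).coeff_xiDeriv hs0 hss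
  have h1 := WBound.coeff_mul (fun i hi => (hf i hi).coeff_xiDeriv hs0 hss) hP' hs0
  have h2 := WBound.coeff_mul (fun i hi => (hw i hi).coeff_xiDeriv hs0 hss) hP' hs0
  have h3 := WBound.coeff_mul (c := fun i => 1 * c i)
    (fun i hi => by rw [one_mul]; exact (hw i hi).mono hs0 hss.le) hdP hs0
  rw [conv_const_mul] at h1 h2 h3
  have h0 : 0 ≤ (s' - s)⁻¹ * conv c (conv c c) j := mul_nonneg hd hK
  refine ⟨h1.mono_const ?_, ?_⟩
  · nlinarith
  · rw [rhsW, map_sub]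
    exact (h2.sub h3 hs0).mono_const (by nlinarith)

theorem wBound_coeff_formal_solution (hF : WBound R (PowerSeries.coeff 0 f) M)
    (hW : WBound R (PowerSeries.coeff 0 w) M) (hf : d⁄dX ℂ⟦X⟧ f = rhsF f w)
    (hw : d⁄dX ℂ⟦X⟧ w = rhsW w) (hA0 : A 0 = M)
    (hA : ∀ j, A (j + 1) = 24 * R * conv A (conv A A) j) (hAnn : ∀ j, 0 ≤ A j) (j : ℕ) :
    ∀ s, 1 ≤ s → s < R → WBound s (PowerSeries.coeff j f) (A j * (R - s)⁻¹ ^ j) ∧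
      WBound s (PowerSeries.coeff j w) (A j * (R - s)⁻¹ ^ j) := by
  induction j using Nat.strong_induction_on with
  | _ j ih =>
    intro s hs hsR
    have hs0 : 0 ≤ s := zero_le_one.trans hs
    rcases j with _ | j
    · rw [hA0, pow_zero, mul_one]
      exact ⟨hF.mono hs0 hsR.le, hW.mono hs0 hsR.le⟩
    have hδ : 0 < R - s := sub_pos.2 hsR
    -- Shrinking by the fraction 1/(j + 2) of the gap balances two losses: the derivative costs (j +
    -- 2)/(R - s), compensated by the division by j + 1, and (R - s')^(-j) exceeds (R - s)^(-j) by a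
    -- bounded factor. These are the 2 and the 3 in 24R = 4R · 2 · 3.
    obtain ⟨s', hs'⟩ : ∃ s', s' = s + (R - s) / (j + 2) := ⟨_, rfl⟩
    have hss : s < s' := by rw [hs']; exact lt_add_of_pos_right _ (by positivity)
    have h1 : R - s' = (R - s) * ((j + 1) / (j + 2)) := by rw [hs']; field_simp; ring
    have hsR' : s' < R := by
      rw [← sub_pos, h1]; positivity
    obtain ⟨hb1, hb2⟩ := wBound_rhs (j := j) (c := fun i => A i * (R - s')⁻¹ ^ i) hs hss hsR'.le
      (fun i => mul_nonneg (hAnn i) (pow_nonneg (inv_nonneg.2 (sub_pos.2 hsR').le) i))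
      (fun i hi => (ih i (by omega) s' (hs.trans hss.le) hsR').1)
      (fun i hi => (ih i (by omega) s' (hs.trans hss.le) hsR').2)
    have hconv : conv (fun i => A i * (R - s')⁻¹ ^ i)
        (conv (fun i => A i * (R - s')⁻¹ ^ i) (fun i => A i * (R - s')⁻¹ ^ i)) j =
        conv A (conv A A) j * (R - s')⁻¹ ^ j := by
      rw [← conv_mul_pow]
      exact conv_congr (fun _ _ => rfl) fun i _ => conv_mul_pow A A _ i
    have hle : (s' - s)⁻¹ * (4 * R) * (conv A (conv A A) j * (R - s')⁻¹ ^ j) / (j + 1) ≤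
        A (j + 1) * (R - s)⁻¹ ^ (j + 1) := by
      have h2 : (s' - s)⁻¹ = (R - s)⁻¹ * (j + 2) := by
        rw [hs', add_sub_cancel_left, inv_div, div_eq_inv_mul]
      have h3 : (R - s')⁻¹ = (R - s)⁻¹ * ((j + 2) / (j + 1)) := by rw [h1]; field_simp
      have h4 : ((j : ℝ) + 2) / (j + 1) ≤ 2 := by
        rw [div_le_iff₀ (by positivity)]; linarith [(Nat.cast_nonneg j : (0 : ℝ) ≤ j)]
      have h5 : ((j : ℝ) + 2) / (j + 1) * (((j : ℝ) + 2) / (j + 1)) ^ j ≤ 2 * 3 :=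
        mul_le_mul h4 (one_add_inv_pow_le j) (by positivity) (by positivity)
      have h6 : 0 ≤ conv A (conv A A) j := conv_nonneg hAnn (conv_nonneg hAnn hAnn) j
      have hR : 0 ≤ R := hs0.trans hsR.le
      rw [h2, h3, hA, mul_pow]
      calc _ = 4 * R * conv A (conv A A) j * (R - s)⁻¹ ^ (j + 1) *
            (((j : ℝ) + 2) / (j + 1) * (((j : ℝ) + 2) / (j + 1)) ^ j) := by
            rw [pow_succ (R - s)⁻¹]; field_simp
        _ ≤ 4 * R * conv A (conv A A) j * (R - s)⁻¹ ^ (j + 1) * (2 * 3) := by gcongr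
        _ = _ := by ring
    rw [hconv] at hb1 hb2
    rw [← hf, PowerSeries.coeff_derivative] at hb1
    rw [← hw, PowerSeries.coeff_derivative] at hb2
    exact ⟨hb1.of_mul_natCast.mono_const hle, hb2.of_mul_natCast.mono_const hle⟩

end Majorant

/-! ### Convergence of double series. -/

section TimeBound

/-- The weighted `ℓ¹` norm of a double series, with weights `s ^ n` in the inner and `σ ^ j` in the
outer variable, is at most `M`. -/
def TBound (s σ : ℝ) (x : ℂ⟦X⟧⟦X⟧) (M : ℝ) : Prop :=
  ∃ c : ℕ → ℝ, (∀ j, WBound s (PowerSeries.coeff j x) (c j)) ∧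
    ∀ K, ∑ j ∈ Finset.range K, c j * σ ^ j ≤ M

theorem exists_tBound {R M : ℝ} {f w : ℂ⟦X⟧⟦X⟧} (hM : 0 < M)
    (hF : WBound R (PowerSeries.coeff 0 f) M)
    (hW : WBound R (PowerSeries.coeff 0 w) M) (hf : d⁄dX ℂ⟦X⟧ f = rhsF f w)
    (hw : d⁄dX ℂ⟦X⟧ w = rhsW w) {s : ℝ} (hs : 1 ≤ s) (hsR : s < R) :
    ∃ σ, 0 < σ ∧ TBound s σ f (2 * M) ∧ TBound s σ w (2 * M) := by
  have hR : 0 < R := zero_lt_one.trans_le (hs.trans hsR.le)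
  obtain ⟨A, hA0, hA, hAnn, τ, hτ, hτA⟩ := exists_majorant (c := 24 * R) hM (by positivity)
  have hδ : 0 < R - s := sub_pos.2 hsR
  have hb := fun j => wBound_coeff_formal_solution hF hW hf hw hA0 hA hAnn j s hs hsR
  have hsum : ∀ K, ∑ j ∈ Finset.range K, A j * (R - s)⁻¹ ^ j * (τ * (R - s)) ^ j ≤ 2 * M := by
    intro K
    refine le_trans (le_of_eq (Finset.sum_congr rfl fun j _ => ?_)) (hτA K)
    rw [mul_assoc, ← mul_pow]
    congr 2
    field_simp
  -- The factor R - s in σ absorbs the growth (R - s)^(-j) of the coefficient bounds.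
  exact ⟨τ * (R - s), by positivity, ⟨_, fun j => (hb j).1, hsum⟩, ⟨_, fun j => (hb j).2, hsum⟩⟩

/-- The power series in the outer variable obtained by evaluating the inner one. -/
noncomputable def slice (x : ℂ⟦X⟧⟦X⟧) (ξ : ℂ) : ℂ⟦X⟧ :=
  PowerSeries.mk fun j => ev (PowerSeries.coeff j x) ξ

theorem coeff_slice (j : ℕ) (x : ℂ⟦X⟧⟦X⟧) (ξ : ℂ) :
    PowerSeries.coeff j (slice x ξ) = ev (PowerSeries.coeff j x) ξ := PowerSeries.coeff_mk _ _

theorem slice_derivative (x : ℂ⟦X⟧⟦X⟧) (ξ : ℂ) :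
    slice (d⁄dX ℂ⟦X⟧ x) ξ = d⁄dX ℂ (slice x ξ) := by
  ext j
  rw [coeff_slice, PowerSeries.coeff_derivative, PowerSeries.coeff_derivative, coeff_slice]
  have h1 : ((j : ℂ⟦X⟧) + 1) = PowerSeries.C (j + 1 : ℂ) := by simp
  rw [h1, ev, ev, ← tsum_mul_right]
  refine tsum_congr fun n => ?_
  rw [PowerSeries.coeff_mul_C]
  ring

variable {s s' σ M M' : ℝ} {x y : ℂ⟦X⟧⟦X⟧} {ξ : ℂ}

namespace TBound

theorem mono (h : TBound s' σ x M) (hs : 0 ≤ s) (hss : s ≤ s') : TBound s σ x M := by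
  obtain ⟨c, hc, hM⟩ := h
  exact ⟨c, fun j => (hc j).mono hs hss, hM⟩

theorem nonneg (h : TBound s σ x M) : 0 ≤ M := by
  obtain ⟨c, hc, hM⟩ := h
  simpa using hM 0

theorem mul (hx : TBound s σ x M) (hy : TBound s σ y M') (hs : 0 ≤ s) (hσ : 0 ≤ σ) :
    TBound s σ (x * y) (M * M') := by
  have hM0 := hx.nonneg
  obtain ⟨c, hc, hM⟩ := hx
  obtain ⟨d, hd, hM'⟩ := hy
  refine ⟨conv c d, fun j => WBound.coeff_mul (fun i _ => hc i) (fun i _ => hd i) hs, fun K => ?_⟩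
  exact (sum_range_conv_mul_pow_le (fun n => (hc n).nonneg) (fun n => (hd n).nonneg) hσ K).trans
    (mul_le_mul (hM K) (hM' K)
      (Finset.sum_nonneg fun j _ => mul_nonneg (hd j).nonneg (by positivity)) hM0)

theorem schwarzSeries (hx : TBound s σ x M) (hs : 1 ≤ s) (hσ : 0 ≤ σ) :
    TBound s σ (schwarzSeries x) (2 * (M * M)) := by
  have hM0 := hx.nonneg
  obtain ⟨c, hc, hM⟩ := hx
  refine ⟨fun j => 2 * conv c c j, fun j => WBound.coeff_schwarzSeries (fun i _ => hc i) hs,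
    fun K => ?_⟩
  simp_rw [mul_assoc, ← Finset.mul_sum]
  gcongr
  exact (sum_range_conv_mul_pow_le (fun n => (hc n).nonneg) (fun n => (hc n).nonneg) hσ K).trans
    (mul_le_mul (hM K) (hM K)
      (Finset.sum_nonneg fun j _ => mul_nonneg (hc j).nonneg (by positivity)) hM0)

theorem xiDeriv (hx : TBound s' σ x M) (hs : 0 ≤ s) (hss : s < s') :
    TBound s σ (xiDeriv x) ((s' - s)⁻¹ * M) := by
  obtain ⟨c, hc, hM⟩ := hx
  refine ⟨fun j => (s' - s)⁻¹ * c j, fun j => (hc j).coeff_xiDeriv hs hss, fun K => ?_⟩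
  simp_rw [mul_assoc, ← Finset.mul_sum]
  exact mul_le_mul_of_nonneg_left (hM K) (inv_nonneg.2 (sub_pos.2 hss).le)

theorem wBound_slice (hx : TBound s σ x M) (hσ : 0 ≤ σ) (hξ : ‖ξ‖ ≤ s) :
    WBound σ (slice x ξ) M := by
  obtain ⟨c, hc, hM⟩ := hx
  refine fun K => le_trans (Finset.sum_le_sum fun j _ => ?_) (hM K)
  rw [coeff_slice]
  gcongr
  exact (hc j).norm_ev_le hξ

theorem slice_mul (hx : TBound s σ x M) (hy : TBound s σ y M') (hξ : ‖ξ‖ ≤ s) :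
    slice (x * y) ξ = slice x ξ * slice y ξ := by
  obtain ⟨c, hc, -⟩ := hx
  obtain ⟨d, hd, -⟩ := hy
  have hs : 0 ≤ s := (norm_nonneg ξ).trans hξ
  ext j
  have h1 : ∀ p ∈ Finset.HasAntidiagonal.antidiagonal j,
      WBound s (PowerSeries.coeff p.1 x * PowerSeries.coeff p.2 y) (c p.1 * d p.2) :=
    fun p _ => (hc p.1).mul (hd p.2) hs
  rw [coeff_slice, PowerSeries.coeff_mul, PowerSeries.coeff_mul, ev_sum _ h1 hξ]
  refine Finset.sum_congr rfl fun p _ => ?_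
  rw [ev_mul (hc _) (hd _) hξ, coeff_slice, coeff_slice]

/-- A double series converges to a function that is analytic in the inner variable. -/
theorem hasDerivAt_ev_slice (hx : TBound s σ x M) (hξ : ‖ξ‖ < s) {t : ℂ} (ht : ‖t‖ ≤ σ) :
    HasDerivAt (fun ζ => ev (slice x ζ) t) (ev (slice (PolubarinovaGalin.xiDeriv x) ξ) t) ξ := by
  obtain ⟨c, hc, hM⟩ := hx
  have hσ : 0 ≤ σ := (norm_nonneg t).trans ht
  have hsum : Summable fun j => c j * σ ^ j :=
    summable_of_sum_range_le (fun j => mul_nonneg (hc j).nonneg (by positivity)) hM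
  have hmem : ξ ∈ Metric.ball (0 : ℂ) s := by simpa using hξ
  have hdiff : ∀ j, DifferentiableOn ℂ (fun ζ => PowerSeries.coeff j (slice x ζ) * t ^ j)
      (Metric.ball 0 s) := fun j => by
    simp_rw [coeff_slice]
    exact (hc j).differentiableOn_ev.mul_const _
  have hle : ∀ j, ∀ ζ ∈ Metric.ball (0 : ℂ) s,
      ‖PowerSeries.coeff j (slice x ζ) * t ^ j‖ ≤ c j * σ ^ j := fun j ζ hζ => by
    rw [coeff_slice, norm_mul, norm_pow]
    have := (hc j).nonneg
    gcongr
    exact (hc j).norm_ev_le (by simpa using (Metric.mem_ball.1 hζ).le)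
  have h1 := ((Complex.differentiableOn_tsum_of_summable_norm hsum hdiff Metric.isOpen_ball
    hle).differentiableAt (Metric.isOpen_ball.mem_nhds hmem)).hasDerivAt
  have h2 := Complex.hasSum_deriv_of_summable_norm hsum hdiff Metric.isOpen_ball hle hmem
  rw [← h2.tsum_eq] at h1
  have h3 : ev (slice (PolubarinovaGalin.xiDeriv x) ξ) t =
      ∑' j, deriv (fun ζ => PowerSeries.coeff j (slice x ζ) * t ^ j) ξ := by
    refine tsum_congr fun j => ?_
    simp_rw [coeff_slice]
    rw [deriv_mul_const ((hc j).hasDerivAt_ev hξ).differentiableAt, (hc j).deriv_ev hξ,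
      PolubarinovaGalin.coeff_xiDeriv]
  rw [h3]
  exact h1

end TBound

end TimeBound

/-! ### The Schwarz integral and the formal operator. -/

section Schwarz

theorem schwarzP_eq_circleAverage (h : ℂ → ℂ) (ξ : ℂ) :
    schwarzP h ξ = Real.circleAverage (fun z => h z * ((z + ξ) / (z - ξ))) 0 1 := by
  rw [Real.circleAverage_eq_circleIntegral one_ne_zero, schwarzP, smul_eq_mul]
  congr 2
  ext z
  rw [sub_zero, smul_eq_mul, div_eq_inv_mul]

/-- The **Schwarz integral formula**. -/
theorem schwarzP_eq_of_re {g h : ℂ → ℂ} (hg : DiffContOnCl ℂ g (Metric.ball 0 1))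
    (hg0 : conj (g 0) = g 0) (hh : ∀ z, ‖z‖ = 1 → 2 * h z = g z + conj (g z)) {ξ : ℂ}
    (hξ : ‖ξ‖ < 1) : schwarzP h ξ = g ξ := by
  have hne : ∀ z : ℂ, ‖z‖ = 1 → z - ξ ≠ 0 := fun z hz h => by
    rw [sub_eq_zero.1 h] at hz
    linarith
  have hne' : ∀ z : ℂ, ‖z‖ ≤ 1 → 1 - conj ξ * z ≠ 0 := fun z hz h => by
    have h1 : ‖conj ξ * z‖ = 1 := by rw [← sub_eq_zero.1 h, norm_one]
    rw [norm_mul, RCLike.norm_conj] at h1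
    nlinarith [norm_nonneg ξ, norm_nonneg z]
  have hsph : ∀ z ∈ Metric.sphere (0 : ℂ) |1|, ‖z‖ = 1 := fun z hz => by simpa using hz
  have hgc : ContinuousOn g (Metric.sphere 0 |1|) := hg.continuousOn_ball.mono fun z hz => by
    simp [hsph z hz]
  have hk : DiffContOnCl ℂ (fun z => g z / (1 - conj ξ * z)) (Metric.ball 0 1) := by
    have h1 : DiffContOnCl ℂ (fun z => (1 - conj ξ * z)⁻¹) (Metric.ball 0 1) := by
      refine DiffContOnCl.inv (Differentiable.diffContOnCl (by fun_prop)) fun z hz => hne' z ?_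
      rw [closure_ball _ one_ne_zero] at hz
      simpa using hz
    simpa [div_eq_mul_inv, mul_comm] using h1.smul hg
  have hkc : ContinuousOn (fun z => g z / (1 - conj ξ * z)) (Metric.sphere 0 |1|) :=
    hk.continuousOn_ball.mono fun z hz => by simp [hsph z hz]
  have e1 : Real.circleAverage (fun z => (z / (z - ξ)) * g z) 0 1 = g ξ := by
    have := DiffContOnCl.circleAverage_smul_div (c := 0) (R := 1) (w := ξ) (f := g)
      (by simpa using hg) (by simpa using hξ)
    simpa using this
  have e2 : Real.circleAverage g 0 1 = g 0 :=
    DiffContOnCl.circleAverage (by simpa using hg)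
  have e3 : Real.circleAverage (fun z => g z / (1 - conj ξ * z)) 0 1 = g 0 := by
    have := DiffContOnCl.circleAverage (c := 0) (R := 1) (f := fun z => g z / (1 - conj ξ * z))
      (by simpa using hk)
    simpa using this
  have c1 : CircleIntegrable (fun z => (z / (z - ξ)) * g z) 0 1 := by
    refine ContinuousOn.circleIntegrable' (ContinuousOn.mul ?_ hgc)
    exact ContinuousOn.div (by fun_prop) (by fun_prop) fun z hz => hne z (hsph z hz)
  have c2 : CircleIntegrable g 0 1 := ContinuousOn.circleIntegrable' hgc
  have c3 : CircleIntegrable (fun z => g z / (1 - conj ξ * z)) 0 1 :=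
    ContinuousOn.circleIntegrable' hkc
  have hconj : ∀ {k : ℂ → ℂ}, CircleIntegrable k 0 1 →
      Real.circleAverage (fun z => conj (k z)) 0 1 = conj (Real.circleAverage k 0 1) :=
    fun hk => Complex.conjCLE.toContinuousLinearMap.circleAverage_comp_comm hk
  have cconj : ∀ {k : ℂ → ℂ}, ContinuousOn k (Metric.sphere 0 |1|) →
      CircleIntegrable (fun z => conj (k z)) 0 1 :=
    fun hk => ContinuousOn.circleIntegrable' (Complex.continuous_conj.comp_continuousOn hk)
  have hhalf : ∀ {k : ℂ → ℂ} (a : ℂ), CircleIntegrable k 0 1 →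
      CircleIntegrable (fun z => a * k z) 0 1 := fun a hk => hk.const_smul
  have cadd : ∀ {k l : ℂ → ℂ}, CircleIntegrable k 0 1 → CircleIntegrable l 0 1 →
      CircleIntegrable (fun z => k z + l z) 0 1 := fun hk hl => hk.add hl
  -- Write the kernel as 2z/(z - ξ) - 1. On the circle z/(z - ξ) is the conjugate of 1/(1 - conj ξ
  -- z), so the antianalytic part becomes the conjugate of an analytic function, whose mean is its
  -- value at 0.
  have hpt : EqOn (fun z => h z * ((z + ξ) / (z - ξ)))
      (fun z => (((z / (z - ξ)) * g z) + (-1 / 2) * g z) +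
        (conj (g z / (1 - conj ξ * z)) + (-1 / 2) * conj (g z))) (Metric.sphere 0 |1|) := by
    intro z hz
    have hz1 := hsph z hz
    have hzz : z * conj z = 1 := by rw [Complex.mul_conj, Complex.normSq_eq_norm_sq, hz1]; simp
    have h1 : conj (1 - conj ξ * z) = (z - ξ) / z := by
      have hz0 : z ≠ 0 := fun h => by simp [h] at hz1
      rw [eq_div_iff hz0]
      simp only [map_sub, map_mul, map_one, Complex.conj_conj]
      linear_combination (-ξ) * hzz
    have hz0 : z ≠ 0 := fun h => by simp [h] at hz1
    have h2 : h z = (g z + conj (g z)) / 2 := by rw [← hh z hz1]; ring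
    have h3 := hne z hz1
    simp only [map_div₀, h1, h2]
    field_simp
    ring
  rw [schwarzP_eq_circleAverage, Real.circleAverage_congr_sphere hpt,
    Real.circleAverage_fun_add (cadd c1 (hhalf _ c2)) (cadd (cconj hkc) (hhalf _ (cconj hgc))),
    Real.circleAverage_fun_add c1 (hhalf _ c2),
    Real.circleAverage_fun_add (cconj hkc) (hhalf _ (cconj hgc)), hconj c3, e1, e3]
  have e4 : Real.circleAverage (fun z => (-1 / 2 : ℂ) * g z) 0 1 = (-1 / 2 : ℂ) * g 0 := by
    have := Real.circleAverage_fun_smul (a := (-1 / 2 : ℂ)) (f := g) (c := 0) (R := 1)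
    rw [e2] at this
    exact this
  have e5 : Real.circleAverage (fun z => (-1 / 2 : ℂ) * conj (g z)) 0 1 =
      (-1 / 2 : ℂ) * conj (g 0) := by
    have := Real.circleAverage_fun_smul (a := (-1 / 2 : ℂ)) (f := fun z => conj (g z)) (c := 0)
      (R := 1)
    rw [hconj c2, e2] at this
    exact this
  rw [e4, e5, hg0]
  ring

variable {s σ M : ℝ} {w : ℂ⟦X⟧⟦X⟧} {z : ℂ} {t : ℝ}

/-- As t is real, conjugation acts on the Taylor coefficients in t alone, and the identity reduces
to `two_mul_ev_mul_conj_ev` at each order. Swapping the antidiagonal matches the conjugate parts. -/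
theorem two_mul_ev_slice_mul_conj (hw : TBound s σ w M) (hs : 1 ≤ s) (hz : ‖z‖ = 1)
    (ht : |t| ≤ σ) : 2 * (ev (slice w z) t * conj (ev (slice w z) t)) =
      ev (slice (schwarzSeries w) z) t + conj (ev (slice (schwarzSeries w) z) t) := by
  have hσ : 0 ≤ σ := (abs_nonneg t).trans ht
  have ht' : ‖(t : ℂ)‖ ≤ σ := by rwa [Complex.norm_real]
  have hzs : ‖z‖ ≤ s := by rw [hz]; exact hs
  have h1 := hw.wBound_slice hσ hzs
  have h2 := (hw.schwarzSeries hs hσ).wBound_slice hσ hzs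
  rw [conj_ev, conj_ev, Complex.conj_ofReal, ← ev_mul h1 h1.map_conj ht',
    ← ev_add h2 h2.map_conj ht', two_mul, ← ev_add (h1.mul h1.map_conj hσ)
    (h1.mul h1.map_conj hσ) ht']
  congr 1
  obtain ⟨c, hc, -⟩ := hw
  ext j
  have hp : ∀ p ∈ Finset.HasAntidiagonal.antidiagonal j,
      WBound s (schwarzPair (PowerSeries.coeff p.1 w) (PowerSeries.coeff p.2 w))
        (2 * (c p.1 * c p.2)) := fun p _ => (hc p.1).schwarzPair (hc p.2) hs
  rw [map_add, map_add, PowerSeries.coeff_map, coeff_slice, coeff_schwarzSeries,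
    ev_sum _ hp hzs, map_sum, PowerSeries.coeff_mul, ← two_mul, Finset.mul_sum]
  rw [← Finset.Nat.sum_antidiagonal_swap (f := fun p => conj (ev (schwarzPair
    (PowerSeries.coeff p.1 w) (PowerSeries.coeff p.2 w)) z)), ← Finset.sum_add_distrib]
  refine Finset.sum_congr rfl fun p _ => ?_
  rw [PowerSeries.coeff_map, coeff_slice, coeff_slice,
    two_mul_ev_mul_conj_ev hs (hc p.1) (hc p.2) hz]
  rfl

theorem schwarzP_ev_slice_mul_conj (hw : TBound s σ w M) (hs : 1 < s) {ξ : ℂ} (hξ : ‖ξ‖ < 1)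
    (ht : |t| ≤ σ) : schwarzP (fun z => ev (slice w z) t * conj (ev (slice w z) t)) ξ =
      ev (slice (schwarzSeries w) ξ) t := by
  have hσ : 0 ≤ σ := (abs_nonneg t).trans ht
  have ht' : ‖(t : ℂ)‖ ≤ σ := by rwa [Complex.norm_real]
  refine schwarzP_eq_of_re (g := fun ζ => ev (slice (schwarzSeries w) ζ) t) ?_ ?_
    (fun z hz => two_mul_ev_slice_mul_conj hw hs.le hz ht) hξ
  · refine DifferentiableOn.diffContOnCl fun ζ hζ => ?_
    rw [closure_ball _ one_ne_zero] at hζ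
    exact ((hw.schwarzSeries hs.le hσ).hasDerivAt_ev_slice
      (lt_of_le_of_lt (by simpa using hζ) hs) ht').differentiableAt.differentiableWithinAt
  · rw [conj_ev, Complex.conj_ofReal]
    congr 1
    ext j
    rw [PowerSeries.coeff_map, coeff_slice, ev_zero_right, conj_constantCoeff_schwarzSeries]

end Schwarz

/-! ### Local injectivity and nonvanishing derivative. -/

section LocalInjectivity

theorem exists_injOn_of_deriv_ne_zero {f : ℂ → ℂ} {z : ℂ} (hf : AnalyticAt ℂ f z)
    (hd : deriv f z ≠ 0) : ∃ U ∈ 𝓝 z, InjOn f U := by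
  have h : HasStrictFDerivAt f
      (ContinuousLinearEquiv.unitsEquivAut ℂ (Units.mk0 _ hd) : ℂ →L[ℂ] ℂ) z :=
    hf.hasStrictDerivAt.hasStrictFDerivAt_equiv hd
  exact ⟨_, (h.toOpenPartialHomeomorph f).open_source.mem_nhds
    h.mem_toOpenPartialHomeomorph_source, (h.toOpenPartialHomeomorph f).injOn⟩

/-- If f' vanished, then f - f(z) = g(z) φⁿ near z with n ≥ 2 and a local coordinate φ. Points whose
φ-values differ by an n-th root of unity have the same image. -/
theorem deriv_ne_zero_of_injOn {f : ℂ → ℂ} {z : ℂ} {U : Set ℂ} (hf : AnalyticAt ℂ f z)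
    (hU : U ∈ 𝓝 z) (hinj : InjOn f U) : deriv f z ≠ 0 := by
  intro hd
  have hz : z ∈ U := mem_of_mem_nhds hU
  have hF : AnalyticAt ℂ (fun w => f w - f z) z := hf.sub analyticAt_const
  have hnc : ¬ ∀ᶠ w in 𝓝 z, f w - f z = 0 := by
    intro h
    have h1 : ∀ᶠ w in 𝓝[≠] z, w ∈ U ∧ f w - f z = 0 ∧ w ≠ z := by
      filter_upwards [nhdsWithin_le_nhds hU, nhdsWithin_le_nhds h, self_mem_nhdsWithin]
        with w h1 h2 h3 using ⟨h1, h2, h3⟩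
    obtain ⟨w, h1, h2, h3⟩ := h1.exists
    exact h3 (hinj h1 hz (sub_eq_zero.1 h2))
  obtain ⟨n, g, hg, hgz, hfg⟩ := hF.exists_eventuallyEq_pow_smul_nonzero_iff.2 hnc
  simp only [smul_eq_mul] at hfg
  have hn0 : n ≠ 0 := by
    rintro rfl
    have := hfg.self_of_nhds
    simp [hgz.symm] at this
  have hn1 : n ≠ 1 := by
    rintro rfl
    have h1 : HasDerivAt (fun w => (w - z) ^ 1 * g w) (g z) z := by
      have := ((hasDerivAt_id z).sub_const z).fun_mul hg.differentiableAt.hasDerivAt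
      simpa using this
    have h2 : deriv (fun w => f w - f z) z = g z := by
      rw [EventuallyEq.deriv_eq hfg, h1.deriv]
    rw [deriv_sub_const, hd] at h2
    exact hgz h2.symm
  have hnC : (n : ℂ) ≠ 0 := by exact_mod_cast hn0
  -- The quotient g(w)/g(z) is near 1, so the principal logarithm supplies an analytic n-th root.
  let φ : ℂ → ℂ := fun w => (w - z) * Complex.exp (Complex.log (g w / g z) / n)
  have hquot : AnalyticAt ℂ (fun w => Complex.exp (Complex.log (g w / g z) / n)) z := by
    have h1 : AnalyticAt ℂ (fun w => g w / g z) z := hg.div analyticAt_const hgz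
    have h2 : AnalyticAt ℂ (fun w => Complex.log (g w / g z)) z :=
      h1.clog (by rw [div_self hgz]; exact Complex.one_mem_slitPlane)
    exact (h2.div analyticAt_const hnC).cexp
  have hφ : AnalyticAt ℂ φ z := (analyticAt_id.sub analyticAt_const).mul hquot
  have hφd : deriv φ z = 1 := by
    have := ((hasDerivAt_id z).sub_const z).fun_mul hquot.differentiableAt.hasDerivAt
    have h2 : HasDerivAt φ 1 z := by simpa [div_self hgz] using this
    exact h2.deriv
  have hmap := hφ.hasStrictDerivAt.map_nhds_eq (by rw [hφd]; exact one_ne_zero)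
  have hφz : φ z = 0 := by simp [φ]
  have hV : {w | w ∈ U ∧ f w - f z = (w - z) ^ n * g w ∧ g w ≠ 0} ∈ 𝓝 z := by
    filter_upwards [hU, hfg, hg.continuousAt.eventually_ne hgz] with w h1 h2 h3
      using ⟨h1, h2, h3⟩
  have hpow : ∀ w, f w - f z = (w - z) ^ n * g w → g w ≠ 0 → φ w ^ n * g z = f w - f z := by
    intro w h1 h2
    simp only [φ]
    rw [mul_pow, ← Complex.exp_nat_mul, mul_div_cancel₀ _ hnC,
      Complex.exp_log (div_ne_zero h2 hgz), mul_assoc, div_mul_cancel₀ _ hgz, h1]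
  have him := image_mem_map (m := φ) hV
  rw [hmap, hφz] at him
  obtain ⟨ε, hε, hball⟩ := Metric.mem_nhds_iff.1 him
  have hζ := Complex.isPrimitiveRoot_exp n hn0
  set ζ := Complex.exp (2 * Real.pi * Complex.I / n)
  have ha : ‖((ε / 2 : ℝ) : ℂ)‖ < ε := by
    rw [Complex.norm_real, Real.norm_of_nonneg (by positivity)]
    exact half_lt_self hε
  obtain ⟨w₁, ⟨hw₁, hf₁, hg₁⟩, he₁⟩ := hball (show ((ε / 2 : ℝ) : ℂ) ∈ Metric.ball 0 ε by
    rwa [mem_ball_zero_iff])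
  obtain ⟨w₂, ⟨hw₂, hf₂, hg₂⟩, he₂⟩ := hball (show ζ * ((ε / 2 : ℝ) : ℂ) ∈ Metric.ball 0 ε by
    rwa [mem_ball_zero_iff, norm_mul, hζ.norm'_eq_one hn0, one_mul])
  have hw : w₁ = w₂ := by
    refine hinj hw₁ hw₂ (sub_left_injective (b := f z) ?_)
    show f w₁ - f z = f w₂ - f z
    rw [← hpow w₁ hf₁ hg₁, ← hpow w₂ hf₂ hg₂, he₁, he₂, mul_pow, hζ.pow_eq_one, one_mul]
  rw [← hw, he₁] at he₂
  have hε' : ((ε / 2 : ℝ) : ℂ) ≠ 0 := by exact_mod_cast (half_pos hε).ne'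
  have : ζ = 1 := mul_right_cancel₀ hε' (by rw [one_mul, ← he₂])
  exact hζ.ne_one (by omega) this

end LocalInjectivity

/-! ### Expansion of the initial data. -/

section InitialData

theorem WBound.C (s : ℝ) (a : ℂ) : WBound s (PowerSeries.C a) ‖a‖ := by
  intro K
  rcases K with _ | K
  · simp
  · rw [Finset.sum_eq_single_of_mem 0 (by simp)]
    · simp
    · intro n _ hn
      simp [PowerSeries.coeff_C, hn]

/-- Analyticity together with f₀' ≠ 0 is an open condition, so by compactness it persists on a disc
of radius r + δ. Any R strictly between r and r + δ gives finite norms for f₀ and 1/f₀', leaving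
room for the later loss of radius. -/
theorem exists_initial_series {r : ℝ} (hr : 0 < r) {f₀ : ℂ → ℂ}
    (hω : MemOmega (Metric.closedBall 0 r) f₀) :
    ∃ R M : ℝ, ∃ F W : ℂ⟦X⟧, r < R ∧ 0 < M ∧ WBound R F M ∧ WBound R W M ∧
      d⁄dX ℂ F * W = 1 ∧ PowerSeries.coeff 0 F = 0 ∧
      (∃ a : ℝ, 0 < a ∧ PowerSeries.coeff 0 W = a) ∧ EqOn (ev F) f₀ (Metric.ball 0 r) := by
  have hopen : IsOpen {z | AnalyticAt ℂ f₀ z ∧ deriv f₀ z ≠ 0} := by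
    refine isOpen_iff_mem_nhds.2 fun z hz => ?_
    filter_upwards [hz.1.eventually_analyticAt, hz.1.deriv.continuousAt.eventually_ne hz.2]
      with y h1 h2 using ⟨h1, h2⟩
  have hsub : Metric.closedBall 0 r ⊆ {z | AnalyticAt ℂ f₀ z ∧ deriv f₀ z ≠ 0} := fun z hz => by
    obtain ⟨U, hU, hinj⟩ := hω.locallyUnivalent z hz
    exact ⟨hω.analytic z hz, deriv_ne_zero_of_injOn (hω.analytic z hz) hU hinj⟩
  obtain ⟨δ, hδ, hthick⟩ :=
    (isCompact_closedBall (0 : ℂ) r).exists_cthickening_subset_open hopen hsub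
  rw [cthickening_closedBall hδ.le hr.le] at hthick
  have hR' : 0 < δ + r := by positivity
  obtain ⟨F, hFb, hF⟩ := exists_powerSeries hR' (f := f₀) fun z hz =>
    (hthick hz).1.differentiableAt.differentiableWithinAt
  obtain ⟨W, hWb, hW⟩ := exists_powerSeries hR' (f := fun z => (deriv f₀ z)⁻¹) fun z hz =>
    ((hthick hz).1.deriv.differentiableAt.inv (hthick hz).2).differentiableWithinAt
  obtain ⟨R, hrR, hRδ⟩ := exists_between (lt_add_of_pos_left r hδ)
  have hR0 : 0 < R := hr.trans hrR
  obtain ⟨C₁, hC₁⟩ := hFb R hR0.le hRδ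
  obtain ⟨C₂, hC₂⟩ := hWb R hR0.le hRδ
  have hball : ∀ ξ : ℂ, ‖ξ‖ < δ + r → AnalyticAt ℂ f₀ ξ ∧ deriv f₀ ξ ≠ 0 := fun ξ hξ =>
    hthick (by simpa using hξ.le)
  refine ⟨R, max 1 (max C₁ C₂), F, W, hrR, by positivity,
    hC₁.mono_const ((le_max_left _ _).trans (le_max_right _ _)),
    hC₂.mono_const ((le_max_right _ _).trans (le_max_right _ _)), ?_, ?_, ?_, ?_⟩
  · have hd := hC₁.derivative hr.le hrR
    have hW' := hC₂.mono hr.le hrR.le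
    refine eq_of_ev_eq hr (hd.mul hW' hr.le) (v := 1) (by simpa using WBound.C r 1)
      fun ξ hξ => ?_
    have hξR : ‖ξ‖ < δ + r := (hξ.trans hrR).trans hRδ
    have heq : ev F =ᶠ[𝓝 ξ] f₀ := by
      filter_upwards [Metric.isOpen_ball.mem_nhds
        (show ξ ∈ Metric.ball (0 : ℂ) (δ + r) by simpa using hξR)] with z hz
      exact hF z (by simpa using hz)
    rw [ev_mul hd hW' hξ.le, ev_one, ← hC₁.deriv_ev (hξ.trans hrR), heq.deriv_eq, hW ξ hξR]
    exact mul_inv_cancel₀ (hball ξ hξR).2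
  · rw [← ev_zero_right, hF 0 (by simpa using hR'), hω.map_zero]
  · obtain ⟨a, ha, hda⟩ := hω.deriv_zero_pos
    refine ⟨a⁻¹, inv_pos.2 ha, ?_⟩
    rw [← ev_zero_right, hW 0 (by simpa using hR'), hda, Complex.ofReal_inv]
  · intro ξ hξ
    have : ‖ξ‖ < r := by simpa using hξ
    exact hF ξ ((this.trans hrR).trans hRδ)

end InitialData

/-! ### Quantitative differentiability in time. -/

section TimeRegularity

variable {σ ρ C : ℝ} {u : ℂ⟦X⟧} {t t' : ℂ}

theorem WBound.norm_ev_sub_le (hu : WBound σ u C) (hρ : ρ < σ) (ht : ‖t‖ ≤ ρ)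
    (ht' : ‖t'‖ ≤ ρ) : ‖ev u t' - ev u t‖ ≤ C / (σ - ρ) * ‖t' - t‖ := by
  have hρ0 : 0 ≤ ρ := (norm_nonneg t).trans ht
  refine Convex.norm_image_sub_le_of_norm_hasDerivWithin_le (s := Metric.closedBall (0 : ℂ) ρ)
    (f' := ev (d⁄dX ℂ u)) (fun x hx => ?_) (fun x hx => ?_) (convex_closedBall _ _)
    (by simpa using ht) (by simpa using ht')
  · have hx' : ‖x‖ ≤ ρ := by simpa using hx
    exact (hu.hasDerivAt_ev (hx'.trans_lt hρ)).hasDerivWithinAt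
  · exact (hu.derivative hρ0 hρ).norm_ev_le (by simpa using hx)

/-- A Taylor estimate by the mean value inequality applied twice. The constant depends on u only
through C, so it is uniform in ξ when applied to slices. -/
theorem WBound.norm_ev_sub_sub_le (hu : WBound σ u C) (hρ : ρ < σ) (ht : ‖t‖ ≤ ρ)
    (ht' : ‖t'‖ ≤ ρ) : ‖ev u t' - ev u t - ev (d⁄dX ℂ u) t * (t' - t)‖ ≤
      C / ((σ - ρ) / 2) / ((σ - ρ) / 2) * ‖t' - t‖ * ‖t' - t‖ := by
  have hρ0 : 0 ≤ ρ := (norm_nonneg t).trans ht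
  have hd : WBound ((σ + ρ) / 2) (d⁄dX ℂ u) (C / ((σ - ρ) / 2)) := by
    have := hu.derivative (s := (σ + ρ) / 2) (by linarith) (by linarith)
    rwa [show σ - (σ + ρ) / 2 = (σ - ρ) / 2 by ring] at this
  -- Intersecting with the ball around t keeps |x - t| ≤ |t' - t|, which produces the second factor.
  have hconv : Convex ℝ (Metric.closedBall (0 : ℂ) ρ ∩ Metric.closedBall t ‖t' - t‖) :=
    (convex_closedBall _ _).inter (convex_closedBall _ _)
  have key := hconv.norm_image_sub_le_of_norm_hasDerivWithin_le
    (f := fun x => ev u x - ev (d⁄dX ℂ u) t * x) (f' := fun x => ev (d⁄dX ℂ u) x - ev (d⁄dX ℂ u) t)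
    (C := C / ((σ - ρ) / 2) / ((σ - ρ) / 2) * ‖t' - t‖) (x := t) (y := t')
    (fun x hx => by
      have hx' : ‖x‖ ≤ ρ := by simpa using hx.1
      have h1 := (hu.hasDerivAt_ev (hx'.trans_lt hρ)).sub
        ((hasDerivAt_id x).const_mul (ev (d⁄dX ℂ u) t))
      rw [mul_one] at h1
      exact h1.hasDerivWithinAt)
    (fun x hx => by
      have hx' : ‖x‖ ≤ ρ := by simpa using hx.1
      have h1 := hd.norm_ev_sub_le (ρ := ρ) (by linarith) ht hx'
      rw [show (σ + ρ) / 2 - ρ = (σ - ρ) / 2 by ring] at h1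
      have h0 : 0 ≤ C / ((σ - ρ) / 2) / ((σ - ρ) / 2) := by
        have := hu.nonneg
        have := sub_pos.2 hρ
        positivity
      refine h1.trans (mul_le_mul_of_nonneg_left ?_ h0)
      simpa [dist_eq_norm] using hx.2)
    ⟨by simpa using ht, by simp⟩ ⟨by simpa using ht', by simp [dist_eq_norm]⟩
  refine le_trans (le_of_eq ?_) key
  congr 1
  ring

theorem tendstoUniformlyOn_of_norm_sub_le {J : Set ℝ} {U : Set ℂ} {t L : ℝ} {F : ℝ → ℂ → ℂ}
    {G : ℂ → ℂ} (h : ∀ s ∈ J, ∀ ξ ∈ U, ‖F s ξ - G ξ‖ ≤ L * |s - t|) :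
    TendstoUniformlyOn F G (𝓝[J] t) U := by
  rw [Metric.tendstoUniformlyOn_iff]
  intro ε hε
  have hlim : Tendsto (fun s => L * |s - t|) (𝓝[J] t) (𝓝 0) := by
    have : Tendsto (fun s => L * |s - t|) (𝓝 t) (𝓝 (L * |t - t|)) :=
      (Continuous.tendsto (by fun_prop) t)
    simpa using this.mono_left nhdsWithin_le_nhds
  filter_upwards [hlim.eventually_lt_const hε, self_mem_nhdsWithin] with s h1 h2 ξ hξ
  rw [dist_comm, dist_eq_norm]
  exact (h s h2 ξ hξ).trans_lt h1

end TimeRegularity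

/-! ### From the double series to a strong* solution. -/

section Solution

theorem TBound.xi {s : ℝ} (σ : ℝ) (hs : 0 ≤ s) : TBound s σ xi s := by
  refine ⟨fun j => if j = 0 then s else 0, fun j => ?_, fun K => ?_⟩
  · rw [PolubarinovaGalin.xi, PowerSeries.coeff_C]
    dsimp only
    split_ifs
    · exact WBound.X hs
    · exact WBound.zero
  · rcases K with _ | K
    · simpa using hs
    · rw [Finset.sum_eq_single_of_mem 0 (by simp)]
      · simp
      · intro n _ hn
        simp [hn]

theorem slice_C (u : ℂ⟦X⟧) (ξ : ℂ) :
    slice (PowerSeries.C u) ξ = PowerSeries.C (ev u ξ) := by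
  ext j
  rw [coeff_slice, PowerSeries.coeff_C, PowerSeries.coeff_C]
  split_ifs
  · rfl
  · exact ev_zero

theorem ev_C (a t : ℂ) : ev (PowerSeries.C a) t = a := by
  rw [ev, tsum_eq_single 0 fun n hn => by simp [PowerSeries.coeff_C, hn]]
  simp

variable {s s' σ M M' : ℝ} {f w : ℂ⟦X⟧⟦X⟧} {ξ t : ℂ}

theorem TBound.rhsF (hf : TBound s' σ f M) (hw : TBound s' σ w M) (hs : 1 ≤ s) (hss : s < s')
    (hσ : 0 ≤ σ) : ∃ M', TBound s σ (rhsF f w) M' :=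
  have hs0 : 0 ≤ s := zero_le_one.trans hs
  ⟨_, (hf.xiDeriv hs0 hss).mul ((TBound.xi σ hs0).mul
    ((hw.mono hs0 hss.le).schwarzSeries hs hσ) hs0 hσ) hs0 hσ⟩

theorem ev_slice_mul {x y : ℂ⟦X⟧⟦X⟧} (hx : TBound s σ x M) (hy : TBound s σ y M')
    (hξ : ‖ξ‖ ≤ s) (ht : ‖t‖ ≤ σ) :
    ev (slice (x * y) ξ) t = ev (slice x ξ) t * ev (slice y ξ) t := by
  have hσ : 0 ≤ σ := (norm_nonneg t).trans ht
  rw [hx.slice_mul hy hξ, ev_mul (hx.wBound_slice hσ hξ) (hy.wBound_slice hσ hξ) ht]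

theorem ev_slice_rhsF (hf : TBound s' σ f M) (hw : TBound s' σ w M) (hs : 1 ≤ s) (hss : s < s')
    (hξ : ‖ξ‖ ≤ s) (ht : ‖t‖ ≤ σ) : ev (slice (rhsF f w) ξ) t =
      ev (slice (xiDeriv f) ξ) t * (ξ * ev (slice (schwarzSeries w) ξ) t) := by
  have hσ : 0 ≤ σ := (norm_nonneg t).trans ht
  have hs0 : 0 ≤ s := zero_le_one.trans hs
  have hP := (hw.mono hs0 hss.le).schwarzSeries hs hσ
  rw [rhsF, ev_slice_mul (hf.xiDeriv hs0 hss) ((TBound.xi σ hs0).mul hP hs0 hσ) hξ ht,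
    ev_slice_mul (TBound.xi σ hs0) hP hξ ht, xi, slice_C, ev_C, ev_X]

theorem ev_slice_xiDeriv_mul (hf : TBound s' σ f M) (hw : TBound s' σ w M)
    (hfw : xiDeriv f * w = 1) (hξ : ‖ξ‖ < s') (ht : ‖t‖ ≤ σ) :
    ev (slice (xiDeriv f) ξ) t * ev (slice w ξ) t = 1 := by
  rw [← ev_slice_mul (hf.xiDeriv (norm_nonneg ξ) hξ) (hw.mono (norm_nonneg ξ) hξ.le) le_rfl ht,
    hfw, ← map_one PowerSeries.C, slice_C, ev_C, ev_one]

theorem schwarzP_congr {g h : ℂ → ℂ} (H : ∀ z, ‖z‖ = 1 → g z = h z) (ξ : ℂ) :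
    schwarzP g ξ = schwarzP h ξ := by
  rw [schwarzP_eq_circleAverage, schwarzP_eq_circleAverage]
  refine Real.circleAverage_congr_sphere fun z hz => ?_
  simp only [H z (by simpa using hz)]

theorem pgRHS_ev_slice {t : ℝ} (hf : TBound s' σ f M) (hw : TBound s' σ w M)
    (hfw : xiDeriv f * w = 1) (hs' : 1 < s') (hξ : ‖ξ‖ < 1) (ht : |t| ≤ σ) :
    pgRHS (fun ζ => ev (slice f ζ) t) ξ = ev (slice (rhsF f w) ξ) t := by
  have ht' : ‖(t : ℂ)‖ ≤ σ := by rwa [Complex.norm_real]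
  have hder : ∀ z : ℂ, ‖z‖ ≤ 1 →
      deriv (fun ζ => ev (slice f ζ) t) z = ev (slice (xiDeriv f) z) t := fun z hz =>
    (hf.hasDerivAt_ev_slice (hz.trans_lt hs') ht').deriv
  rw [pgRHS, ev_slice_rhsF hf hw le_rfl hs' hξ.le ht', hder ξ hξ.le,
    ← schwarzP_ev_slice_mul_conj hw hs' hξ ht]
  rw [schwarzP_congr (h := fun z => ev (slice w z) t * conj (ev (slice w z) t)) fun z hz => ?_]
  · ring
  · have h1 := ev_slice_xiDeriv_mul hf hw hfw (ξ := z) (by rw [hz]; exact hs') ht'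
    rw [hder z hz.le, Complex.mul_conj, Complex.normSq_eq_norm_sq, eq_inv_of_mul_eq_one_left h1,
      norm_inv, inv_pow, one_div, inv_inv]

theorem memOmega_ev_slice {E : Set ℂ} {t : ℝ} (hf : TBound s' σ f M) (hw : TBound s' σ w M)
    (hfw : xiDeriv f * w = 1) (hs' : 0 < s') (hE : E ⊆ Metric.ball 0 s') (ht : |t| ≤ σ)
    (hf0 : ∀ j, PowerSeries.coeff 0 (PowerSeries.coeff j f) = 0)
    (hw0 : ∃ a : ℝ, 0 < a ∧ ev (slice w 0) t = a) :
    MemOmega E fun ζ => ev (slice f ζ) t := by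
  have ht' : ‖(t : ℂ)‖ ≤ σ := by rwa [Complex.norm_real]
  have hder : ∀ z : ℂ, ‖z‖ < s' →
      HasDerivAt (fun ζ => ev (slice f ζ) t) (ev (slice (xiDeriv f) z) t) z := fun z hz =>
    hf.hasDerivAt_ev_slice hz ht'
  have han : AnalyticOnNhd ℂ (fun ζ => ev (slice f ζ) t) (Metric.ball 0 s') :=
    DifferentiableOn.analyticOnNhd (fun z hz =>
      (hder z (by simpa using hz)).differentiableAt.differentiableWithinAt) Metric.isOpen_ball
  refine ⟨han.mono hE, fun z hz => ?_, ?_, ?_⟩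
  · have hz' : ‖z‖ < s' := by simpa using hE hz
    refine exists_injOn_of_deriv_ne_zero (han z (hE hz)) ?_
    rw [(hder z hz').deriv]
    exact left_ne_zero_of_mul_eq_one (ev_slice_xiDeriv_mul hf hw hfw hz' ht')
  · have : slice f 0 = 0 := by
      ext j
      rw [coeff_slice, ev_zero_right, hf0, map_zero]
    rw [this, ev_zero]
  · obtain ⟨a, ha, hwa⟩ := hw0
    have h0 : ‖(0 : ℂ)‖ < s' := by simpa using hs'
    refine ⟨a⁻¹, inv_pos.2 ha, ?_⟩
    have h1 := ev_slice_xiDeriv_mul hf hw hfw h0 ht'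
    rw [(hder 0 h0).deriv, eq_inv_of_mul_eq_one_left h1, hwa, Complex.ofReal_inv]

/-- A real-valued power series without zeros on an interval keeps its sign there. -/
theorem exists_pos_ev_eq {u : ℂ⟦X⟧} {C t₀ : ℝ} (hu : WBound σ u C) (ht₀ : t₀ < σ)
    (hreal : ∀ j, conj (PowerSeries.coeff j u) = PowerSeries.coeff j u)
    (h0 : ∃ a : ℝ, 0 < a ∧ PowerSeries.coeff 0 u = a)
    (hne : ∀ t ∈ Icc 0 t₀, ev u ((t : ℝ) : ℂ) ≠ 0) {t : ℝ} (ht : t ∈ Icc 0 t₀) :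
    ∃ a : ℝ, 0 < a ∧ ev u t = a := by
  have hre : ∀ t : ℝ, ev u t = ((ev u t).re : ℂ) := fun t => by
    refine (Complex.conj_eq_iff_re.1 ?_).symm
    rw [conj_ev, Complex.conj_ofReal]
    congr 1
    ext j
    rw [PowerSeries.coeff_map, hreal]
  refine ⟨(ev u t).re, ?_, hre t⟩
  by_contra hle
  rw [not_lt] at hle
  obtain ⟨a, ha, hua⟩ := h0
  have hcont : ContinuousOn (fun x : ℝ => (ev u x).re) (Icc 0 t) := fun x hx => by
    have hx' : ‖(x : ℂ)‖ < σ := by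
      rw [Complex.norm_real, Real.norm_of_nonneg hx.1]
      exact (hx.2.trans ht.2).trans_lt ht₀
    exact (Complex.continuous_re.continuousAt.comp (f := fun x : ℝ => ev u x)
      (ContinuousAt.comp (hu.hasDerivAt_ev hx').continuousAt
        Complex.continuous_ofReal.continuousAt)).continuousWithinAt
  have hstart : 0 ≤ (ev u ((0 : ℝ) : ℂ)).re := by
    rw [Complex.ofReal_zero, ev_zero_right, hua, Complex.ofReal_re]
    exact ha.le
  obtain ⟨x, hx, hx0⟩ := intermediate_value_Icc' ht.1 hcont ⟨hle, hstart⟩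
  refine hne x ⟨hx.1, hx.2.trans ht.2⟩ ?_
  rw [hre x]
  simp only at hx0
  rw [hx0, Complex.ofReal_zero]

theorem isC1Holomorphic_ev_slice {t₀ r : ℝ} (hf : TBound s' σ f M) (hw : TBound s' σ w M)
    (hfeq : d⁄dX ℂ⟦X⟧ f = rhsF f w) (hr : 1 < r) (hrs : r < s') (hσ : t₀ < σ) :
    IsC1Holomorphic (Icc 0 t₀) (Metric.ball 0 r) fun t ζ => ev (slice f ζ) t := by
  have hnorm : ∀ t ∈ Icc 0 t₀, ‖((t : ℝ) : ℂ)‖ ≤ t₀ := fun t ht => by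
    rw [Complex.norm_real, Real.norm_of_nonneg ht.1]
    exact ht.2
  have hball : ∀ ξ ∈ Metric.ball (0 : ℂ) r, ‖ξ‖ < r := fun ξ hξ => by simpa using hξ
  refine ⟨fun t ht => ?_, fun t ζ => ev (slice (d⁄dX ℂ⟦X⟧ f) ζ) t, fun t ht => ?_,
    fun t ht => ?_, fun t ht => ?_⟩
  · refine DifferentiableOn.analyticOnNhd (fun z hz => ?_) Metric.isOpen_ball
    exact (hf.hasDerivAt_ev_slice ((hball z hz).trans hrs)
      ((hnorm t ht).trans hσ.le)).differentiableAt.differentiableWithinAt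
  · obtain ⟨M', hM'⟩ := hf.rhsF hw hr.le hrs ((norm_nonneg _).trans ((hnorm t ht).trans hσ.le))
    -- Through the equation, the time derivative inherits a bound with the same σ; the cost is paid
    -- in the radius in ξ, between s' and r.
    rw [hfeq]
    refine DifferentiableOn.analyticOnNhd (fun z hz => ?_) Metric.isOpen_ball
    exact (hM'.hasDerivAt_ev_slice (hball z hz)
      ((hnorm t ht).trans hσ.le)).differentiableAt.differentiableWithinAt
  · refine (tendstoUniformlyOn_of_norm_sub_le
      (L := M / ((σ - t₀) / 2) / ((σ - t₀) / 2)) fun s hs ξ hξ => ?_).tendstoLocallyUniformlyOn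
    have hσ0 : 0 ≤ σ := (norm_nonneg _).trans ((hnorm t ht).trans hσ.le)
    have h1 := (hf.wBound_slice hσ0 ((hball ξ hξ).trans hrs).le).norm_ev_sub_sub_le hσ
      (hnorm t ht) (hnorm s hs.1)
    have hst : (s : ℂ) - t ≠ 0 := by
      rw [sub_ne_zero]
      exact_mod_cast hs.2
    have hst' : ‖(s : ℂ) - t‖ = |s - t| := by
      rw [← Complex.ofReal_sub, Complex.norm_real, Real.norm_eq_abs]
    dsimp only
    rw [slice_derivative, Complex.ofReal_sub, div_sub' hst, norm_div,
      div_le_iff₀ (norm_pos_iff.2 hst), mul_comm ((s : ℂ) - t)]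
    rwa [hst'] at h1 ⊢
  · have hσ0 : 0 ≤ σ := (norm_nonneg _).trans ((hnorm t ht).trans hσ.le)
    have ht0 : 0 ≤ t₀ := ht.1.trans ht.2
    refine (tendstoUniformlyOn_of_norm_sub_le
      (L := M / (σ - (σ + t₀) / 2) / ((σ + t₀) / 2 - t₀))
      fun s hs ξ hξ => ?_).tendstoLocallyUniformlyOn
    have h1 := ((hf.wBound_slice hσ0 ((hball ξ hξ).trans hrs).le).derivative
      (s := (σ + t₀) / 2) (by linarith) (by linarith)).norm_ev_sub_le
      (by linarith) (hnorm t ht) (hnorm s hs)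
    dsimp only
    rw [slice_derivative]
    rwa [← Complex.ofReal_sub, Complex.norm_real, Real.norm_eq_abs] at h1

end Solution

end PolubarinovaGalin

/-! ### Assembly of the theorem. -/

open PolubarinovaGalin

theorem mainTheorem6 (r ρ₀ : ℝ) (hr : 1 < r) (hρ : r < ρ₀) (f₀ : ℂ → ℂ)
    (hω : MemOmega (Metric.closedBall 0 r) f₀)
    (hH : AnalyticOnNhd ℂ f₀ (Metric.closedBall 0 ρ₀)) :
    ∃ t₀ : ℝ, 0 < t₀ ∧ ∃ f : ℝ → ℂ → ℂ,
      IsStrongStarSolution (Icc 0 t₀) f ∧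
      IsC1Holomorphic (Icc 0 t₀) (Metric.ball 0 r) f ∧
      (∀ t ∈ Icc 0 t₀, MemOmega (Metric.ball 0 r) (f t)) ∧
      EqOn (f 0) f₀ (Metric.ball 0 r) := by
  obtain ⟨R, M, F, W, hrR, hM, hFb, hWb, hFW, hF0, hW0, hFf⟩ :=
    exists_initial_series (zero_lt_one.trans hr) hω
  obtain ⟨f, w, rfl, rfl, hf, hw⟩ := exists_formal_solution F W
  obtain ⟨s, hrs, hsR⟩ := exists_between hrR
  obtain ⟨σ, hσ, hfb, hwb⟩ := exists_tBound hM hFb hWb hf hw (hr.trans hrs).le hsR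
  have hfw := xiDeriv_mul_eq_one hFW hf hw
  have hs0 : 0 < s := zero_lt_one.trans (hr.trans hrs)
  have hlt : σ / 2 < σ := half_lt_self hσ
  have habs : ∀ t ∈ Icc 0 (σ / 2), |t| < σ := fun t ht => by
    rw [abs_of_nonneg ht.1]
    exact ht.2.trans_lt hlt
  have hpos : ∀ t ∈ Icc 0 (σ / 2), ∃ a : ℝ, 0 < a ∧ ev (slice w 0) ((t : ℝ) : ℂ) = a := by
    intro t ht
    refine exists_pos_ev_eq (hwb.wBound_slice hσ.le (by simpa using hs0.le)) hlt (fun j => ?_) ?_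
      (fun t ht => ?_) ht
    · rw [coeff_slice, ev_zero_right]
      obtain ⟨a, -, ha⟩ := hW0
      exact conj_constantCoeff_coeff (by rw [ha, Complex.conj_ofReal]) hw j
    · rwa [coeff_slice, ev_zero_right]
    -- The identity f' w = 1 at ξ = 0 excludes zeros of w(0,t), so the sign at t = 0 persists.
    · refine right_ne_zero_of_mul_eq_one (ev_slice_xiDeriv_mul hfb hwb hfw (by simpa using hs0) ?_)
      rw [Complex.norm_real]
      exact (habs t ht).le
  have hmem : ∀ t ∈ Icc 0 (σ / 2), ∀ E ⊆ Metric.ball (0 : ℂ) s,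
      MemOmega E fun ζ => ev (slice f ζ) t := fun t ht E hE =>
    memOmega_ev_slice hfb hwb hfw hs0 hE (habs t ht).le (constantCoeff_coeff_eq_zero hF0 hf)
      (hpos t ht)
  -- Halving σ keeps the closed time interval inside the open disc of convergence in t, so the
  -- derivatives at its endpoints are those of the power series.
  refine ⟨σ / 2, half_pos hσ, fun t ζ => ev (slice f ζ) t, ⟨?_, ?_, ?_⟩,
    isC1Holomorphic_ev_slice hfb hwb hf hr hrs hlt, ?_, ?_⟩
  · exact fun t ht => hmem t ht _ (Metric.closedBall_subset_ball (hr.trans hrs))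
  · intro ξ hξ
    have hξ' : ‖ξ‖ ≤ s := (show ‖ξ‖ ≤ 1 by simpa using hξ).trans (hr.trans hrs).le
    have h1 := ((hfb.wBound_slice hσ.le hξ').differentiableOn_ev.contDiffOn (n := 1)
      Metric.isOpen_ball).restrict_scalars ℝ
    refine h1.comp Complex.ofRealCLM.contDiff.contDiffOn fun t ht => ?_
    simpa using habs t ht
  · intro t ht ξ hξ
    have hξ1 : ‖ξ‖ < 1 := by simpa using hξ
    rw [pgRHS_ev_slice hfb hwb hfw (hr.trans hrs) hξ1 (habs t ht).le, ← hf, slice_derivative]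
    refine HasDerivAt.hasDerivWithinAt (HasDerivAt.comp_ofReal
      ((hfb.wBound_slice hσ.le (hξ1.trans (hr.trans hrs)).le).hasDerivAt_ev ?_))
    rw [Complex.norm_real]
    exact habs t ht
  · exact fun t ht => hmem t ht _ (Metric.ball_subset_ball hrs.le)
  · intro ξ hξ
    simp only [Complex.ofReal_zero]
    rw [ev_zero_right, coeff_slice]
    exact hFf hξ
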